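/- Let $\mathcal A$ be a finite alphabet. A bi-infinite word is an element $x=(x_n)_{n\in\mathbb Z}$ of $\mathcal A^{\mathbb Z}$, and $S$ is the shift map, $(Sx)_n=x_{n+1}$. A factor of $x$ is a finite word $x_i x_{i+1}\cdots x_{i+n-1}$ with $i\in\mathbb Z$, $n\ge 0$; $\mathcal L_n(x)$ is the set of factors of $x$ of length $n$, and $p_x(n)=\#\mathcal L_n(x)$. The word $x$ is *aperiodic* if there are no $N\in\mathbb Z$, $p\ge 1$ such that $x_n=x_{n+p}$ for all $n\ge N$, and none such that $x_n=x_{n-p}$ for all $n\le N$. It is *uniformly recurrent* if for each factor $u$ of $x$ there is $n$ such that $u$ is a factor of every $v\in\mathcal L_n(x)$. A *shift space* is a subset of $\mathcal A^{\mathbb Z}$ that is closed (for the product of the discrete topologies) and stable under $S$; it is *minimal* if the only shift spaces it contains are itself and $\emptyset$. The *orbit closure* of $x$ is the closure of $\{S^k x : k\in\mathbb Z\}$. A set $\Gamma\subseteq\mathbb Z$ is a *string attractor* of $x$ if every non-empty factor $w$ of $x$ has an occurrence $w=x_i\cdots x_{i+|w|-1}$ with $\{i,\dots,i+|w|-1\}\cap\Gamma\ne\emptyset$.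 The *span* of $x$ is the infimum, over all string attractors $\Gamma$ of $x$, of $\sup\Gamma-\inf\Gamma\in[0,\infty]$. A word $y\in\{0,1\}^{\mathbb Z}$ is *Sturmian* if it is aperiodic and $p_y(n)=n+1$ for all $n\ge 0$. A bi-infinite word $x$ is *quasi-Sturmian* if it is aperiodic and there are $n_0\ge 0$ and $k\ge 1$ with $p_x(n)=n+k$ for all $n\ge n_0$. A shift space is *Sturmian* (resp. *quasi-Sturmian*) if it is the orbit closure of a Sturmian (resp. quasi-Sturmian) word. A *substitution* $\varphi\colon\mathcal A^*\to\mathcal B^*$ is a monoid morphism such that $\varphi(u)$ is non-empty for every non-empty $u$. It acts on bi-infinite words by concatenation, $\varphi(x)=\cdots\varphi(x_{-2})\varphi(x_{-1}).\varphi(x_0)\varphi(x_1)\cdots$ with $\varphi(x_0)$ starting at position $0$, and on shift spaces by $\varphi(\mathbb Y)=\{S^k\varphi(y) : y\in\mathbb Y,\ 0\le k<|\varphi(y_0)|\}$. It is a *return morphism* if it is injective on $\mathcal A$ and there is a non-empty word $w\in\mathcal B^*$ such that, for every letter $a\in\mathcal A$, the word $w\varphi(a)$ contains exactly two occurrences of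 $w$, one as a prefix and one as a suffix. A substitution $\varphi$ defined on $\{0,1\}^*$ is *acyclic* if $\varphi(0)$ and $\varphi(1)$ are not powers of the same word. **Proposition.** (a) Let $x\in\mathcal A^{\mathbb Z}$ be aperiodic and uniformly recurrent. The following assertions are equivalent: 1. there exists a word of finite span in the orbit closure of $x$; 2. $x$ is quasi-Sturmian; 3. there exist a return morphism $\varphi\colon\{0,1\}^*\to\mathcal A^*$, an integer $m$ and a Sturmian word $y$ such that $x=S^m\varphi(y)$; 4. there exist an acyclic substitution $\varphi\colon\{0,1\}^*\to\mathcal A^*$, an integer $m$ and a Sturmian word $y$ such that $x=S^m\varphi(y)$. (b) Let $\mathbb X\subseteq\mathcal A^{\mathbb Z}$ be an infinite minimal shift space. The following assertions are equivalent: 1. there exists $x\in\mathbb X$ of finite span; 2. $\mathbb X$ is quasi-Sturmian; 3. there exist a return morphism $\varphi\colon\{0,1\}^*\to\mathcal A^*$ and a Sturmian shift space $\mathbb Y$ such that $\mathbb X=\varphi(\mathbb Y)$; 4. there exist an acyclic substitution $\varphi\colon\{0,1\}^*\to\mathcal A^*$ and a Sturmian shift space $\mathbb Y$ such that $\mathbb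 X=\varphi(\mathbb Y)$. -/

import Mathlib

namespace BiInfiniteWord

/-! Bi-infinite words over an alphabet `A` are functions `ℤ → A`; finite words are lists. -/

/-- The finite word `x_i x_{i+1} ⋯ x_{i+n-1}`. -/
def block {A : Type*} (x : ℤ → A) (i : ℤ) (n : ℕ) : List A :=
  List.ofFn fun j : Fin n => x (i + (j : ℤ))

/-- `L_n(x)`, the set of factors of length `n` of `x`. -/
def factorsOfLength {A : Type*} (x : ℤ → A) (n : ℕ) : Set (List A) :=
  {w | ∃ i : ℤ, w = block x i n}

/-- `L(x)`, the set of all factors of `x`. -/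
def factors {A : Type*} (x : ℤ → A) : Set (List A) :=
  {w | ∃ n : ℕ, w ∈ factorsOfLength x n}

/-- The factor complexity `p_x(n)`. -/
noncomputable def complexity {A : Type*} (x : ℤ → A) (n : ℕ) : ℕ :=
  (factorsOfLength x n).ncard

def IsPositivelyPeriodic {A : Type*} (x : ℤ → A) : Prop :=
  ∃ N p : ℤ, 0 < p ∧ ∀ n ≥ N, x n = x (n + p)

def IsNegativelyPeriodic {A : Type*} (x : ℤ → A) : Prop :=
  ∃ N p : ℤ, 0 < p ∧ ∀ n ≤ N, x n = x (n - p)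

def IsEventuallyPeriodic {A : Type*} (x : ℤ → A) : Prop :=
  IsPositivelyPeriodic x ∨ IsNegativelyPeriodic x

def IsAperiodic {A : Type*} (x : ℤ → A) : Prop :=
  ¬ IsEventuallyPeriodic x

def IsUniformlyRecurrent {A : Type*} (x : ℤ → A) : Prop :=
  ∀ u ∈ factors x, ∃ n : ℕ, ∀ v ∈ factorsOfLength x n, u <:+: v

/-! ### Shift spaces -/

/-- The power `S^m` of the shift map `S`; in particular `S = shift 1`. -/
def shift {A : Type*} (m : ℤ) (x : ℤ → A) : ℤ → A :=
  fun n => x (n + m)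

def IsShiftSpace {A : Type*} [TopologicalSpace A] (X : Set (ℤ → A)) : Prop :=
  IsClosed X ∧ ∀ x ∈ X, shift 1 x ∈ X

def orbit {A : Type*} (x : ℤ → A) : Set (ℤ → A) :=
  {z | ∃ k : ℤ, z = shift k x}

def orbitClosure {A : Type*} [TopologicalSpace A] (x : ℤ → A) : Set (ℤ → A) :=
  closure (orbit x)

def IsMinimalShiftSpace {A : Type*} [TopologicalSpace A] (X : Set (ℤ → A)) : Prop :=
  IsShiftSpace X ∧ ∀ Y : Set (ℤ → A), IsShiftSpace Y → Y ⊆ X → Y = X ∨ Y = ∅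

/-! ### String attractors and span -/

/-- `w` has an occurrence in `x` crossing a position of `Γ`. -/
def IsCoveredBy {A : Type*} (x : ℤ → A) (w : List A) (Γ : Set ℤ) : Prop :=
  ∃ i : ℤ, block x i w.length = w ∧ (Set.Ico i (i + (w.length : ℤ)) ∩ Γ).Nonempty

def IsStringAttractor {A : Type*} (x : ℤ → A) (Γ : Set ℤ) : Prop :=
  ∀ w ∈ factors x, w ≠ [] → IsCoveredBy x w Γ

/-- `sup Γ - inf Γ`, computed in the extended reals. -/
noncomputable def setSpan (Γ : Set ℤ) : EReal :=
  (⨆ n ∈ Γ, ((n : ℝ) : EReal)) - ⨅ n ∈ Γ, ((n : ℝ) : EReal)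

/-- The string attractor span of a bi-infinite word. -/
noncomputable def wordSpan {A : Type*} (x : ℤ → A) : EReal :=
  ⨅ Γ ∈ {Γ : Set ℤ | IsStringAttractor x Γ}, setSpan Γ

def HasFiniteSpan {A : Type*} (x : ℤ → A) : Prop :=
  wordSpan x < ⊤

/-! ### Sturmian and quasi-Sturmian words and shift spaces -/

/-- Sturmian words over the binary alphabet `{0, 1}`. -/
def IsSturmian (y : ℤ → Fin 2) : Prop :=
  IsAperiodic y ∧ ∀ n : ℕ, complexity y n = n + 1

def IsSturmianShift (Y : Set (ℤ → Fin 2)) : Prop :=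
  ∃ y : ℤ → Fin 2, IsSturmian y ∧ Y = orbitClosure y

def IsQuasiSturmian {A : Type*} (x : ℤ → A) : Prop :=
  IsAperiodic x ∧ ∃ n₀ k : ℕ, 1 ≤ k ∧ ∀ n ≥ n₀, complexity x n = n + k

def IsQuasiSturmianShift {A : Type*} [TopologicalSpace A] (X : Set (ℤ → A)) : Prop :=
  ∃ x : ℤ → A, IsQuasiSturmian x ∧ X = orbitClosure x

/-! ### Substitutions -/

/-- A substitution is a non-erasing morphism between free monoids. -/
structure Substitution (A B : Type*) where
  hom : FreeMonoid A →* FreeMonoid B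
  nonerasing : ∀ u : FreeMonoid A, u ≠ 1 → hom u ≠ 1

namespace Substitution

variable {A B : Type*}

/-- The image of a finite word. -/
def onWord (φ : Substitution A B) (u : List A) : List B :=
  FreeMonoid.toList (φ.hom (FreeMonoid.ofList u))

/-- The image of a letter. -/
def onLetter (φ : Substitution A B) (a : A) : List B :=
  φ.onWord [a]

theorem onWord_append (φ : Substitution A B) (u v : List A) :
    φ.onWord (u ++ v) = φ.onWord u ++ φ.onWord v := by
  simp [onWord, FreeMonoid.ofList_append, FreeMonoid.toList_mul]

theorem length_le_onWord (φ : Substitution A B) (u : List A) :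
    u.length ≤ (φ.onWord u).length := by
  induction u with
  | nil => simp
  | cons a u ih =>
    have h : φ.onWord (a :: u) = φ.onWord [a] ++ φ.onWord u := φ.onWord_append [a] u
    have h1 : 0 < (φ.onWord [a]).length := by
      rw [List.length_pos_iff]
      exact φ.nonerasing (FreeMonoid.ofList [a]) (List.cons_ne_nil a [])
    rw [h, List.length_append, List.length_cons]
    omega

theorem le_onWord_block (φ : Substitution A B) (x : ℤ → A) (i : ℤ) (n : ℕ) :
    n ≤ (φ.onWord (block x i n)).length := by
  simpa [block] using φ.length_le_onWord (block x i n)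

/-- The image `⋯ φ(x_{-2}) φ(x_{-1}) . φ(x_0) φ(x_1) ⋯` of a bi-infinite word: since `φ` is
non-erasing, the letter at position `n ≥ 0` is the one of index `n` in `φ(x_0 ⋯ x_n)`, and the
letter at position `-(n+1) < 0` is the `(n+1)`-st one from the end in `φ(x_{-(n+1)} ⋯ x_{-1})`. -/
def onBiWord (φ : Substitution A B) (x : ℤ → A) : ℤ → B
  | Int.ofNat n =>
      (φ.onWord (block x 0 (n + 1)))[n]'(φ.le_onWord_block x 0 (n + 1))
  | Int.negSucc n =>
      (φ.onWord (block x (Int.negSucc n) (n + 1)))[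
        (φ.onWord (block x (Int.negSucc n) (n + 1))).length - (n + 1)]'(by
          have := φ.le_onWord_block x (Int.negSucc n) (n + 1)
          omega)

/-- The image `φ(X) = {S^k(φ(x)) | x ∈ X, 0 ≤ k < |φ(x_0)|}` of a set of bi-infinite words. -/
def onShift (φ : Substitution A B) (X : Set (ℤ → A)) : Set (ℤ → B) :=
  {z | ∃ x ∈ X, ∃ k : ℕ, k < (φ.onLetter (x 0)).length ∧ z = shift (k : ℤ) (φ.onBiWord x)}

end Substitution

/-- The starting positions of the occurrences of `u` in the finite word `v`. -/
def occurrences {B : Type*} (u v : List B) : Set ℕ :=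
  {i | ∃ p s : List B, v = p ++ u ++ s ∧ p.length = i}

/-- `φ` is injective on letters, and `w φ(a)` contains exactly two occurrences of `w`, one as a
prefix and one as a suffix (these are distinct because `φ(a)` is non-empty). -/
def IsReturnMorphismFor {A B : Type*} (φ : Substitution A B) (w : List B) : Prop :=
  Function.Injective φ.onLetter ∧
    ∀ a : A, occurrences w (w ++ φ.onLetter a) = {0, (φ.onLetter a).length}

def IsReturnMorphism {A B : Type*} (φ : Substitution A B) : Prop :=
  ∃ w : List B, w ≠ [] ∧ IsReturnMorphismFor φ w

/-- `φ(0)` and `φ(1)` are not powers of the same word. -/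
def IsAcyclic {B : Type*} (φ : Substitution (Fin 2) B) : Prop :=
  ¬ ∃ (u : FreeMonoid B) (i j : ℕ),
    φ.hom (FreeMonoid.of 0) = u ^ i ∧ φ.hom (FreeMonoid.of 1) = u ^ j

end BiInfiniteWord

open BiInfiniteWord

/-!
# Bi-infinite words of finite string attractor span

For an aperiodic uniformly recurrent word `x`, all words of its orbit closure have the factors of
`x`, and the four assertions are proved in the cycle finite span ⟹ quasi-Sturmian ⟹ image of a
Sturmian word by a return morphism ⟹ image of a Sturmian word by an acyclic substitution ⟹ finite
span.

* A string attractor contained in `[a, b]` meets at most `n + (b - a)` blocks of length `n`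
  (`IsStringAttractor.complexity_le`). By the Morse–Hedlund theorem `p(n) - n` is nondecreasing, so
  being bounded it is eventually constant (`IsAperiodic.isQuasiSturmian`).
* If `p(n + 1) = p(n) + 1` for all large `n`, there is exactly one right special factor of each
  large length (`rightSpecial_unique`). Such a factor `w` has two return words, determined by
  their first letters (`EnumeratesOccurrences.return_eq`), and cuts `x` into a word `φ(y)`, where `φ` maps the
  letters to the return words. A right special factor `u` of `y` gives a right special factor
  `w φ(u)` of `x`, so `y` has one right special factor of each length: it is Sturmian
  (`IsQuasiSturmian.exists_isReturnMorphism`).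
* Two powers of one word cannot both be return words to the same word, unless they are equal
  (`IsReturnMorphism.isAcyclic`).
* In the orbit closure of a Sturmian word there is, by compactness, a word `z` such that every
  `z_{-N} ⋯ z_{-1}` is right special. Then the `n + 1` blocks of length `n` of `z` meeting `{0, 1}`
  are distinct, so that `{0, 1}` is a string attractor (`IsSturmian.isStringAttractor`): the maximal
  common extension `b`, of length `N`, of two equal ones is bispecial, thus also occurs at position
  `-N`, and its three occurrences are too close to each other. Indeed the blocks of length `N + 1`
  between them form a set closed under predecessors, which must contain all `N + 2` factors of
  length `N + 1` (`IsSturmian.add_two_le_sub`). Finally the positions of `φ(z_0)φ(z_1)` form a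
  string attractor of `φ(z)` (`IsStringAttractor.onBiWord`). That the words of the orbit closure of
  the Sturmian word are aperiodic is inherited from `x`
  (`IsAperiodic.of_factors_subset_preimage`).

The words of an infinite minimal shift space are aperiodic, uniformly recurrent and have it as orbit
closure, which reduces the statement on shift spaces to the one on words.
-/

namespace BiInfiniteWord

/-! ### Blocks and factors -/

section Blocks

variable {A : Type*}

@[simp]
theorem length_block (x : ℤ → A) (i : ℤ) (n : ℕ) : (block x i n).length = n := by
  simp [block]

theorem getElem_block (x : ℤ → A) (i : ℤ) (n t : ℕ) (h : t < (block x i n).length) :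
    (block x i n)[t] = x (i + t) := by
  simp [block]

theorem block_eq_iff {x z : ℤ → A} {i j : ℤ} {n : ℕ} :
    block x i n = block z j n ↔ ∀ t : ℤ, 0 ≤ t → t < n → x (i + t) = z (j + t) := by
  unfold block
  rw [List.ofFn_inj, funext_iff]
  constructor
  · intro h t h0 h1
    lift t to ℕ using h0
    exact h ⟨t, by exact_mod_cast h1⟩
  · intro h t
    exact h t (by positivity) (by exact_mod_cast t.2)

theorem block_add (x : ℤ → A) (i : ℤ) (m n : ℕ) :
    block x i (m + n) = block x i m ++ block x (i + m) n := by
  apply List.ext_getElem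
  · simp
  · intro t h1 h2
    rw [List.getElem_append]
    split_ifs with h
    · simp [block]
    · simp only [block, List.getElem_ofFn, List.length_ofFn] at h ⊢
      congr 1
      push Not at h
      push_cast [h]
      ring

theorem block_one (x : ℤ → A) (i : ℤ) : block x i 1 = [x i] := by
  simp [block]

theorem block_succ_left (x : ℤ → A) (i : ℤ) (n : ℕ) :
    block x i (n + 1) = x i :: block x (i + 1) n := by
  rw [add_comm n 1, block_add, block_one]
  simp

theorem block_succ_right (x : ℤ → A) (i : ℤ) (n : ℕ) :
    block x i (n + 1) = block x i n ++ [x (i + n)] := by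
  rw [block_add, block_one]

theorem block_shift (x : ℤ → A) (m i : ℤ) (n : ℕ) :
    block (shift m x) i n = block x (i + m) n := by
  rw [block_eq_iff]
  intro t _ _
  simp only [shift]
  congr 1
  ring

theorem block_mem_factors (x : ℤ → A) (i : ℤ) (n : ℕ) : block x i n ∈ factors x :=
  ⟨n, i, rfl⟩

theorem block_infix_block (x : ℤ → A) {i j : ℤ} {k n : ℕ} (h0 : i ≤ j)
    (h1 : j + k ≤ i + n) : block x j k <:+: block x i n := by
  obtain ⟨p, rfl⟩ : ∃ p : ℕ, j = i + p := ⟨(j - i).toNat, by omega⟩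
  obtain ⟨q, rfl⟩ : ∃ q : ℕ, n = p + k + q := ⟨n - p - k, by omega⟩
  exact ⟨block x i p, block x (i + (p + k : ℕ)) q, by rw [block_add, block_add]⟩

theorem exists_eq_block_of_infix {x : ℤ → A} {i : ℤ} {n : ℕ} {u : List A}
    (h : u <:+: block x i n) :
    ∃ j : ℤ, i ≤ j ∧ j + u.length ≤ i + n ∧ u = block x j u.length := by
  obtain ⟨s, t, h⟩ := h
  have hl : s.length + u.length + t.length = n := by
    have := congrArg List.length h
    simpa [add_assoc] using this
  refine ⟨i + s.length, by omega, by omega, ?_⟩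
  rw [← hl, block_add, block_add] at h
  have h1 := List.append_inj_left h (by simp)
  exact List.append_inj_right h1 (by simp)

theorem mem_occurrences_block_iff {x : ℤ → A} {i : ℤ} {n t : ℕ} {u : List A} :
    t ∈ occurrences u (block x i n) ↔ t + u.length ≤ n ∧ block x (i + t) u.length = u := by
  constructor
  · rintro ⟨p, s, h, rfl⟩
    have hl : p.length + u.length + s.length = n := by
      have := congrArg List.length h
      simpa [add_assoc] using this.symm
    refine ⟨by omega, ?_⟩
    rw [← hl, block_add, block_add] at h
    have h1 := List.append_inj_left h (by simp)
    exact List.append_inj_right h1 (by simp)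
  · rintro ⟨h1, h2⟩
    obtain ⟨q, rfl⟩ : ∃ q : ℕ, n = t + u.length + q := ⟨n - t - u.length, by omega⟩
    exact ⟨block x i t, block x (i + (t + u.length : ℕ)) q, by rw [block_add, block_add, h2],
      by simp⟩

theorem factorsOfLength_eq_image (x : ℤ → A) (n : ℕ) :
    factorsOfLength x n = (fun i => block x i n) '' Set.univ := by
  ext w
  simp [factorsOfLength, eq_comm]

theorem finite_factorsOfLength [Finite A] (x : ℤ → A) (n : ℕ) : (factorsOfLength x n).Finite := by
  apply (Set.finite_range (List.ofFn : (Fin n → A) → List A)).subset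
  rintro w ⟨i, rfl⟩
  exact ⟨_, rfl⟩

theorem finite_image_block [Finite A] (x : ℤ → A) (I : Set ℤ) (n : ℕ) :
    ((fun i => block x i n) '' I).Finite :=
  (finite_factorsOfLength x n).subset (by rintro _ ⟨i, -, rfl⟩; exact ⟨i, rfl⟩)

theorem factors_subset_iff {z x : ℤ → A} :
    factors z ⊆ factors x ↔ ∀ i n, ∃ j, block z i n = block x j n := by
  constructor
  · intro h i n
    obtain ⟨m, j, hj⟩ := h (block_mem_factors z i n)
    have : n = m := by simpa using congrArg List.length hj
    exact ⟨j, by rw [hj, this]⟩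
  · rintro h w ⟨n, i, rfl⟩
    obtain ⟨j, hj⟩ := h i n
    exact ⟨n, j, hj⟩

theorem factorsOfLength_mono {z x : ℤ → A} (h : factors z ⊆ factors x) (n : ℕ) :
    factorsOfLength z n ⊆ factorsOfLength x n := by
  rintro w ⟨i, rfl⟩
  obtain ⟨j, hj⟩ := factors_subset_iff.1 h i n
  exact ⟨j, hj⟩

theorem factors_shift (m : ℤ) (x : ℤ → A) : factors (shift m x) = factors x := by
  apply Set.Subset.antisymm <;> rw [factors_subset_iff] <;> intro i n
  · exact ⟨i + m, block_shift x m i n⟩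
  · exact ⟨i - m, by rw [block_shift, sub_add_cancel]⟩

theorem shift_shift (m k : ℤ) (x : ℤ → A) : shift m (shift k x) = shift (m + k) x := by
  funext n
  simp [shift, add_assoc]

theorem shift_zero (x : ℤ → A) : shift 0 x = x := by
  funext n
  simp [shift]

theorem complexity_congr {z x : ℤ → A} (h : factors z = factors x) (n : ℕ) :
    complexity z n = complexity x n := by
  unfold complexity
  rw [Set.Subset.antisymm (factorsOfLength_mono h.subset n) (factorsOfLength_mono h.superset n)]

end Blocks

/-! ### Orbit closures and uniform recurrence -/

section Topology

variable {A : Type*}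

theorem mem_orbitClosure_iff [TopologicalSpace A] [DiscreteTopology A] {z x : ℤ → A} :
    z ∈ orbitClosure x ↔ factors z ⊆ factors x := by
  rw [factors_subset_iff]
  unfold orbitClosure
  rw [mem_closure_iff]
  constructor
  · intro h i n
    obtain ⟨_, hy, k, rfl⟩ := h ((Set.Ico i (i + n)).pi fun t => {z t})
      (isOpen_set_pi (Set.finite_Ico _ _) fun _ _ => isOpen_discrete _) (by simp [Set.mem_pi])
    refine ⟨i + k, ?_⟩
    rw [← block_shift, block_eq_iff]
    intro t h0 h1
    exact (hy (i + t) ⟨by omega, by omega⟩).symm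
  · intro h U hU hz
    obtain ⟨I, u, hI, hIU⟩ := isOpen_pi_iff.1 hU z hz
    obtain ⟨M, hM⟩ : ∃ M : ℕ, ∀ a ∈ I, -(M : ℤ) ≤ a ∧ a < M := by
      refine ⟨I.sup Int.natAbs + 1, fun a ha => ?_⟩
      have := Finset.le_sup (f := Int.natAbs) ha
      push_cast
      omega
    obtain ⟨j, hj⟩ := h (-M) (2 * M)
    refine ⟨shift (j + M) x, hIU ?_, j + M, rfl⟩
    intro a ha
    have h1 := (block_eq_iff.1 hj) (a + M) (by have := hM a ha; omega)
      (by have := hM a ha; push_cast; omega)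
    have h2 : shift (j + M) x a = z a := by
      simp only [shift]
      rw [show a + (j + M) = j + (a + M) by ring, ← h1]
      congr 1
      ring
    rw [h2]
    exact (hI a ha).2

theorem self_mem_orbitClosure [TopologicalSpace A] [DiscreteTopology A] (x : ℤ → A) :
    x ∈ orbitClosure x := mem_orbitClosure_iff.2 subset_rfl

theorem IsUniformlyRecurrent.factors_eq {z x : ℤ → A} (hx : IsUniformlyRecurrent x)
    (h : factors z ⊆ factors x) : factors z = factors x := by
  refine h.antisymm fun u hu => ?_
  obtain ⟨n, hn⟩ := hx u hu
  have h1 := hn _ (factorsOfLength_mono h n ⟨0, rfl⟩)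
  obtain ⟨j, -, -, hj⟩ := exists_eq_block_of_infix h1
  exact ⟨_, j, hj⟩

theorem IsUniformlyRecurrent.exists_block_eq_mem_Ico {x : ℤ → A} (hx : IsUniformlyRecurrent x)
    (i : ℤ) (n : ℕ) : ∃ m : ℕ, ∀ c : ℤ, ∃ j, c ≤ j ∧ j + n ≤ c + m ∧ block x j n = block x i n := by
  obtain ⟨m, hm⟩ := hx _ (block_mem_factors x i n)
  refine ⟨m, fun c => ?_⟩
  obtain ⟨j, h1, h2, h3⟩ := exists_eq_block_of_infix (hm _ ⟨c, rfl⟩)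
  rw [length_block] at h2 h3
  exact ⟨j, h1, h2, h3.symm⟩

/-- An aperiodic word does not have the same factors as a periodic word. -/
theorem IsAperiodic.ne_shift_of_factors_eq {z x : ℤ → A} (hx : IsAperiodic x)
    (h : factors z = factors x) {q : ℤ} (hq : 0 < q) : shift q z ≠ z := by
  intro hz
  refine hx (Or.inl ⟨0, q, hq, fun n _ => ?_⟩)
  obtain ⟨j, hj⟩ := factors_subset_iff.1 h.superset n (q.toNat + 1)
  have h0 := block_eq_iff.1 hj 0 le_rfl (by omega)
  have h1 := block_eq_iff.1 hj q hq.le (by omega)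
  rw [add_zero, add_zero] at h0
  rw [h0, h1]
  exact (congrFun hz j).symm

end Topology

/-! ### The Morse–Hedlund theorem on half-lines -/

section MorseHedlund

variable {A : Type*}

theorem ncard_image_block_lt_of_not_isPositivelyPeriodic [Finite A] {x : ℤ → A}
    (hx : ¬ IsPositivelyPeriodic x) {I : Set ℤ} (hI : ∀ i ∈ I, i + 1 ∈ I) (hne : I.Nonempty)
    (n : ℕ) :
    ((fun i => block x i n) '' I).ncard < ((fun i => block x i (n + 1)) '' I).ncard := by
  by_contra! hle
  have himage : List.take n '' ((fun i => block x i (n + 1)) '' I) =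
      (fun i => block x i n) '' I := by
    rw [Set.image_image]
    refine Set.image_congr fun i _ => ?_
    rw [block_succ_right, List.take_left' (by simp)]
  have hinj : Set.InjOn (List.take n) ((fun i => block x i (n + 1)) '' I) := by
    apply Set.injOn_of_ncard_image_eq _ (finite_image_block x I _)
    refine le_antisymm (Set.ncard_image_le (finite_image_block x I _)) ?_
    rwa [himage]
  have hdet : ∀ i ∈ I, ∀ j ∈ I, block x i n = block x j n →
      block x (i + 1) n = block x (j + 1) n ∧ x (i + n) = x (j + n) := by
    intro i hi j hj hij
    have h1 : block x i (n + 1) = block x j (n + 1) := by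
      apply hinj ⟨i, hi, rfl⟩ ⟨j, hj, rfl⟩
      beta_reduce
      rw [block_succ_right, block_succ_right, List.take_left' (by simp), List.take_left' (by simp),
        hij]
    refine ⟨?_, block_eq_iff.1 h1 n (by positivity) (by push_cast; omega)⟩
    rw [block_succ_left, block_succ_left] at h1
    exact (List.cons_eq_cons.1 h1).2
  obtain ⟨i₀, hi₀⟩ := hne
  have hmem : ∀ t : ℕ, i₀ + t ∈ I := by
    intro t
    induction t with
    | zero => simpa using hi₀
    | succ t ih => rw [Nat.cast_succ, ← add_assoc]; exact hI _ ih
  obtain ⟨a, b, hab, heq⟩ : ∃ a b : ℕ, a < b ∧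
      block x (i₀ + a) n = block x (i₀ + b) n := by
    have hnot : ¬ Set.InjOn (fun t : ℕ => block x (i₀ + t) n) Set.univ := by
      intro hinj'
      refine Set.infinite_of_injOn_mapsTo hinj' (fun t _ => ?_) Set.infinite_univ
        (finite_image_block x I n)
      exact ⟨_, hmem t, rfl⟩
    simp only [Set.InjOn, Set.mem_univ, true_implies, not_forall] at hnot
    obtain ⟨a, b, h, hne⟩ := hnot
    rcases lt_or_gt_of_ne hne with h' | h'
    · exact ⟨a, b, h', h⟩
    · exact ⟨b, a, h', h.symm⟩
  have hstep : ∀ t : ℕ, block x (i₀ + a + t) n = block x (i₀ + b + t) n := by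
    intro t
    induction t with
    | zero => simpa using heq
    | succ t ih =>
      have := (hdet _ (by simpa [add_assoc] using hmem (a + t)) _
        (by simpa [add_assoc] using hmem (b + t)) ih).1
      simpa [add_assoc] using this
  refine hx ⟨i₀ + a + n, b - a, by omega, fun k hk => ?_⟩
  obtain ⟨t, rfl⟩ : ∃ t : ℕ, k = i₀ + a + t + n := ⟨(k - (i₀ + a + n)).toNat, by omega⟩
  rw [(hdet _ (by simpa [add_assoc] using hmem (a + t)) _
        (by simpa [add_assoc] using hmem (b + t)) (hstep t)).2]
  congr 1
  ring

theorem lt_ncard_image_block_of_not_isPositivelyPeriodic [Finite A] {x : ℤ → A}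
    (hx : ¬ IsPositivelyPeriodic x) {I : Set ℤ} (hI : ∀ i ∈ I, i + 1 ∈ I) (hne : I.Nonempty)
    (n : ℕ) : n < ((fun i => block x i n) '' I).ncard := by
  induction n with
  | zero => exact (Set.ncard_pos (finite_image_block x I 0)).2 (hne.image _)
  | succ n ih =>
    have := ncard_image_block_lt_of_not_isPositivelyPeriodic hx hI hne n
    omega

theorem complexity_lt_complexity_succ [Finite A] {x : ℤ → A} (hx : ¬ IsPositivelyPeriodic x)
    (n : ℕ) :
    complexity x n < complexity x (n + 1) := by
  unfold complexity
  rw [factorsOfLength_eq_image, factorsOfLength_eq_image]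
  exact ncard_image_block_lt_of_not_isPositivelyPeriodic hx (fun _ _ => Set.mem_univ _)
    Set.univ_nonempty n

theorem lt_complexity [Finite A] {x : ℤ → A} (hx : ¬ IsPositivelyPeriodic x) (n : ℕ) :
    n < complexity x n := by
  unfold complexity
  rw [factorsOfLength_eq_image]
  exact lt_ncard_image_block_of_not_isPositivelyPeriodic hx (fun _ _ => Set.mem_univ _)
    Set.univ_nonempty n

theorem reverse_block (x : ℤ → A) (i : ℤ) (n : ℕ) :
    (block x i n).reverse = block (fun k => x (-k)) (1 - i - n) n := by
  apply List.ext_getElem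
  · simp
  · intro t h1 h2
    rw [List.getElem_reverse]
    rw [getElem_block, getElem_block, length_block]
    simp only [length_block, List.length_reverse] at h1
    congr 1
    omega

/-- On a left half-line, obtained from the statement on right half-lines by reflection. -/
theorem lt_ncard_image_block_Iic_of_not_isNegativelyPeriodic [Finite A] {x : ℤ → A}
    (hx : ¬ IsNegativelyPeriodic x) (M : ℤ) (n : ℕ) :
    n < ((fun i => block x i n) '' Set.Iic M).ncard := by
  have hx' : ¬ IsPositivelyPeriodic (fun k => x (-k)) := by
    rintro ⟨N, p, hp, h⟩
    refine hx ⟨-N, p, hp, fun k hk => ?_⟩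
    have := h (-k) (by omega)
    simp only [neg_neg] at this
    rw [this]
    congr 1
    ring
  have h := lt_ncard_image_block_of_not_isPositivelyPeriodic hx' (I := Set.Ici (1 - M - n))
    (fun i hi => by simp only [Set.mem_Ici] at hi ⊢; omega) ⟨_, Set.self_mem_Ici⟩ n
  rw [← Set.ncard_image_of_injective ((fun i => block x i n) '' Set.Iic M)
    List.reverse_injective]
  convert h using 2
  rw [Set.image_image]
  ext w
  simp only [Set.mem_image, Set.mem_Iic, Set.mem_Ici, reverse_block]
  constructor
  · rintro ⟨i, hi, rfl⟩
    exact ⟨1 - i - n, by omega, rfl⟩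
  · rintro ⟨i, hi, rfl⟩
    exact ⟨1 - i - n, by omega, by congr 1; ring⟩

end MorseHedlund

/-! ### Uniqueness of special factors -/

section Special

theorem pair_eq_of_ncard_le_ncard_image_add_one {α β : Type*} {f : α → β} {S : Set α}
    (hS : S.Finite) (hcard : S.ncard ≤ (f '' S).ncard + 1) {a a' b b' : α} (ha : a ∈ S)
    (ha' : a' ∈ S) (hb' : b' ∈ S) (haa : a ≠ a') (hbb : b ≠ b')
    (hfa : f a = f a') (hfb : f b = f b') (hb : b ∈ S) : b = a ∨ b = a' := by
  by_contra! h
  have himage : f '' S ⊆ f '' (S \ {a, b}) := by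
    rintro _ ⟨s, hs, rfl⟩
    by_cases hsa : s = a
    · exact ⟨a', ⟨ha', by simp [haa.symm, h.2.symm]⟩, by rw [hsa, hfa]⟩
    by_cases hsb : s = b
    · by_cases hba : b' = a
      · exact ⟨a', ⟨ha', by simp [haa.symm, h.2.symm]⟩, by rw [hsb, hfb, hba, hfa]⟩
      · exact ⟨b', ⟨hb', by simp [hba, hbb.symm]⟩, by rw [hsb, hfb]⟩
    · exact ⟨s, ⟨hs, by simp [hsa, hsb]⟩, rfl⟩
  have h1 := Set.ncard_le_ncard himage (hS.sdiff.image f)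
  have h2 := Set.ncard_image_le (f := f) (hS.sdiff (t := {a, b}))
  have h3 : ({a, b} : Set α).ncard = 2 := Set.ncard_pair h.1.symm
  have h4 : (S \ {a, b}).ncard + ({a, b} : Set α).ncard = S.ncard :=
    Set.ncard_sdiff_add_ncard_of_subset (by rintro _ (rfl | rfl) <;> assumption) hS
  omega

theorem ncard_le_ncard_image_add_one {α β : Type*} {f : α → β} {S : Set α} (hS : S.Finite)
    (h : ∀ a ∈ S, ∀ a' ∈ S, ∀ b ∈ S, ∀ b' ∈ S, a ≠ a' → b ≠ b' → f a = f a' → f b = f b' →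
      b = a ∨ b = a') : S.ncard ≤ (f '' S).ncard + 1 := by
  by_cases hinj : Set.InjOn f S
  · rw [hinj.ncard_image]
    omega
  · simp only [Set.InjOn, not_forall] at hinj
    obtain ⟨a, ha, a', ha', hf, hne⟩ := hinj
    have hinj' : Set.InjOn f (S \ {a}) := by
      intro b hb b' hb' hfb
      by_contra hbb
      have h1 := h a ha a' ha' b hb.1 b' hb'.1 hne hbb hf hfb
      have h2 := h a ha a' ha' b' hb'.1 b hb.1 hne (Ne.symm hbb) hf hfb.symm
      have h3 : b ≠ a := hb.2
      have h4 : b' ≠ a := hb'.2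
      exact hbb ((h1.resolve_left h3).trans (h2.resolve_left h4).symm)
    have h1 := hinj'.ncard_image
    have h2 : (f '' (S \ {a})).ncard ≤ (f '' S).ncard :=
      Set.ncard_le_ncard (Set.image_mono Set.sdiff_subset) (hS.image f)
    have h3 := Set.ncard_sdiff_singleton_add_one ha hS
    omega

variable {A : Type*} {x : ℤ → A} {n : ℕ} {i j i' j' : ℤ}

theorem take_image_factorsOfLength (x : ℤ → A) (n : ℕ) :
    List.take n '' factorsOfLength x (n + 1) = factorsOfLength x n := by
  rw [factorsOfLength_eq_image, factorsOfLength_eq_image, Set.image_image]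
  refine Set.image_congr fun i _ => ?_
  rw [block_succ_right, List.take_left' (by simp)]

theorem tail_image_factorsOfLength (x : ℤ → A) (n : ℕ) :
    List.tail '' factorsOfLength x (n + 1) = factorsOfLength x n := by
  ext w
  constructor
  · rintro ⟨_, ⟨i, rfl⟩, rfl⟩
    exact ⟨i + 1, by rw [block_succ_left, List.tail_cons]⟩
  · rintro ⟨i, rfl⟩
    exact ⟨_, ⟨i - 1, rfl⟩, by rw [block_succ_left, List.tail_cons, sub_add_cancel]⟩

/-- If there is one factor more of length `n + 1` than of length `n`, then there is at most one
right special factor of length `n`, and it has at most two right extensions. -/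
theorem rightSpecial_unique [Finite A] (hc : complexity x (n + 1) ≤ complexity x n + 1)
    (hij : block x i n = block x j n) (hne : x (i + n) ≠ x (j + n))
    (hij' : block x i' n = block x j' n) (hne' : x (i' + n) ≠ x (j' + n)) :
    block x i' n = block x i n ∧ (x (i' + n) = x (i + n) ∨ x (i' + n) = x (j + n)) := by
  have key := pair_eq_of_ncard_le_ncard_image_add_one (f := List.take n)
    (finite_factorsOfLength x (n + 1)) (by rwa [take_image_factorsOfLength])
    (a := block x i (n + 1)) (a' := block x j (n + 1)) (b := block x i' (n + 1))
    (b' := block x j' (n + 1)) ⟨i, rfl⟩ ⟨j, rfl⟩ ⟨j', rfl⟩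
    (by simp [block_succ_right, hij, hne]) (by simp [block_succ_right, hij', hne'])
    (by simp [block_succ_right, hij]) (by simp [block_succ_right, hij']) ⟨i', rfl⟩
  simp only [block_succ_right] at key
  rcases key with h | h <;> have h' := List.append_inj h (by simp)
  · exact ⟨h'.1, Or.inl (by simpa using h'.2)⟩
  · exact ⟨h'.1.trans hij.symm, Or.inr (by simpa using h'.2)⟩

/-- If there is one factor more of length `n + 1` than of length `n`, then there is at most one
left special factor of length `n`. -/
theorem leftSpecial_unique [Finite A] (hc : complexity x (n + 1) ≤ complexity x n + 1)
    (hij : block x i n = block x j n) (hne : x (i - 1) ≠ x (j - 1))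
    (hij' : block x i' n = block x j' n) (hne' : x (i' - 1) ≠ x (j' - 1)) :
    block x i' n = block x i n := by
  have hs : ∀ k, block x (k - 1) (n + 1) = x (k - 1) :: block x k n := fun k => by
    rw [block_succ_left, sub_add_cancel]
  have key := pair_eq_of_ncard_le_ncard_image_add_one (f := List.tail)
    (finite_factorsOfLength x (n + 1)) (by rwa [tail_image_factorsOfLength])
    (a := block x (i - 1) (n + 1)) (a' := block x (j - 1) (n + 1))
    (b := block x (i' - 1) (n + 1)) (b' := block x (j' - 1) (n + 1))
    ⟨_, rfl⟩ ⟨_, rfl⟩ ⟨_, rfl⟩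
    (by simp [hs, hne]) (by simp [hs, hne']) (by simp [hs, hij]) (by simp [hs, hij']) ⟨_, rfl⟩
  simp only [hs, List.cons_eq_cons] at key
  rcases key with h | h
  · exact h.2
  · exact h.2.trans hij.symm

theorem exists_rightSpecial (hc : complexity x n < complexity x (n + 1)) :
    ∃ i j, block x i n = block x j n ∧ x (i + n) ≠ x (j + n) := by
  by_contra! h
  refine hc.ne' ?_
  unfold complexity
  rw [← take_image_factorsOfLength x n, Set.InjOn.ncard_image]
  rintro _ ⟨i, rfl⟩ _ ⟨j, rfl⟩ hij
  simp only [block_succ_right] at hij ⊢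
  rw [List.take_left' (by simp), List.take_left' (by simp)] at hij
  rw [hij, h i j hij]

end Special

/-! ### Images of bi-infinite words under substitutions -/

section StrictlyIncreasing

theorem exists_le_lt_succ {e : ℤ → ℤ} (he : ∀ k, e k < e (k + 1)) (t : ℤ) :
    ∃ k, e k ≤ t ∧ t < e (k + 1) := by
  have hmono : StrictMono e := strictMono_int_of_lt_succ he
  have hup : ∀ n : ℕ, e 0 + n ≤ e n := by
    intro n
    induction n with
    | zero => simp
    | succ n ih => have := he n; push_cast; omega
  have hdown : ∀ n : ℕ, e (-n) ≤ e 0 - n := by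
    intro n
    induction n with
    | zero => simp
    | succ n ih =>
      have := he (-n - 1)
      rw [sub_add_cancel] at this
      rw [show (-((n + 1 : ℕ) : ℤ)) = -n - 1 by push_cast; ring]
      push_cast
      omega
  obtain ⟨k, hk, hmax⟩ := Int.exists_greatest_of_bdd (P := fun k => e k ≤ t)
    ⟨(t - e 0).natAbs, fun z hz => by
      by_contra! h
      have := hmono h
      have := hup (t - e 0).natAbs
      omega⟩
    ⟨-(t - e 0).natAbs, by have := hdown (t - e 0).natAbs; omega⟩
  refine ⟨k, hk, ?_⟩
  by_contra! h
  have := hmax _ h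
  omega

theorem exists_enumeration {O : Set ℤ} (hup : ∀ c, ∃ t ∈ O, c < t) (hdown : ∀ c, ∃ t ∈ O, t < c) :
    ∃ e : ℤ → ℤ, (∀ k, e k ∈ O) ∧ (∀ k, e k < e (k + 1)) ∧
      ∀ k t, e k < t → t < e (k + 1) → t ∉ O := by
  classical
  let _ : SuccOrder O := LinearLocallyFiniteOrder.succOrder O
  let _ : PredOrder O := LinearLocallyFiniteOrder.predOrder O
  have : NoMaxOrder O := ⟨fun a => let ⟨t, ht, h⟩ := hup a; ⟨⟨t, ht⟩, h⟩⟩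
  have : NoMinOrder O := ⟨fun a => let ⟨t, ht, h⟩ := hdown a; ⟨⟨t, ht⟩, h⟩⟩
  have : Nonempty O := let ⟨t, ht, _⟩ := hup 0; ⟨⟨t, ht⟩⟩
  let f : O ≃o ℤ := orderIsoIntOfLinearSuccPredArch
  refine ⟨fun k => f.symm k, fun k => (f.symm k).2, fun k => ?_, fun k t h1 h2 ht => ?_⟩
  · exact f.symm.strictMono (lt_add_one k)
  · have h3 : f.symm k < ⟨t, ht⟩ := h1
    have h4 : (⟨t, ht⟩ : O) < f.symm (k + 1) := h2
    rw [OrderIso.symm_apply_lt] at h3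
    rw [OrderIso.lt_symm_apply] at h4
    omega

end StrictlyIncreasing

section Parsing

variable {A B : Type*}

/-- The bi-infinite word `z` is the concatenation of the words `φ(y_k)`, the word `φ(y_k)` starting
at position `e k` of `z`. The origin is left free: `e 0` need not be `0`. -/
structure IsParsing (φ : Substitution A B) (y : ℤ → A) (z : ℤ → B) (e : ℤ → ℤ) : Prop where
  succ : ∀ k, e (k + 1) = e k + (φ.onLetter (y k)).length
  block_eq : ∀ k, block z (e k) (φ.onLetter (y k)).length = φ.onLetter (y k)

theorem Substitution.onWord_nil (φ : Substitution A B) : φ.onWord [] = [] := by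
  have := φ.onWord_append [] []
  simpa using this

theorem Substitution.length_onLetter_pos (φ : Substitution A B) (a : A) :
    0 < (φ.onLetter a).length :=
  φ.length_le_onWord [a]

theorem Substitution.onWord_block_succ_right (φ : Substitution A B) (y : ℤ → A) (k : ℤ) (n : ℕ) :
    φ.onWord (block y k (n + 1)) = φ.onWord (block y k n) ++ φ.onLetter (y (k + n)) := by
  rw [block_succ_right, φ.onWord_append]
  rfl

theorem Substitution.onWord_block_succ_left (φ : Substitution A B) (y : ℤ → A) (k : ℤ) (n : ℕ) :
    φ.onWord (block y k (n + 1)) = φ.onLetter (y k) ++ φ.onWord (block y (k + 1) n) := by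
  rw [block_succ_left, ← List.singleton_append, φ.onWord_append]
  rfl

namespace IsParsing

variable {φ : Substitution A B} {y y' : ℤ → A} {z z' : ℤ → B} {e e' : ℤ → ℤ}

theorem lt_succ (h : IsParsing φ y z e) (k : ℤ) : e k < e (k + 1) := by
  have := φ.length_onLetter_pos (y k)
  rw [h.succ]
  omega

theorem strictMono (h : IsParsing φ y z e) : StrictMono e :=
  strictMono_int_of_lt_succ h.lt_succ

theorem add_natCast (h : IsParsing φ y z e) (k : ℤ) (n : ℕ) :
    e (k + n) = e k + (φ.onWord (block y k n)).length := by
  induction n with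
  | zero => simp [block, φ.onWord_nil]
  | succ n ih =>
    rw [Nat.cast_succ, ← add_assoc, h.succ, ih, φ.onWord_block_succ_right, List.length_append]
    push_cast
    ring

theorem block_eq_onWord (h : IsParsing φ y z e) (k : ℤ) (n : ℕ) :
    block z (e k) (φ.onWord (block y k n)).length = φ.onWord (block y k n) := by
  induction n with
  | zero => simp [block, φ.onWord_nil]
  | succ n ih =>
    rw [φ.onWord_block_succ_right, List.length_append, block_add, ih, ← h.add_natCast,
      h.block_eq]

/-- Equal blocks of the preimages give equal blocks of the images. -/
theorem transfer (h : IsParsing φ y z e) (h' : IsParsing φ y' z' e') {k k' : ℤ} {n : ℕ}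
    (hb : block y k n = block y' k' n) :
    e (k + n) - e k = e' (k' + n) - e' k' ∧
      ∀ t, 0 ≤ t → t < e (k + n) - e k → z (e k + t) = z' (e' k' + t) := by
  have h1 := h.block_eq_onWord k n
  have h2 := h'.block_eq_onWord k' n
  rw [← hb] at h2
  refine ⟨by rw [h.add_natCast, h'.add_natCast, hb]; ring, fun t h0 ht => ?_⟩
  refine block_eq_iff.1 (h1.trans h2.symm) t h0 ?_
  rw [h.add_natCast] at ht
  omega

theorem onBiWord_eq (h : IsParsing φ y z e) (h0 : e 0 = 0) : φ.onBiWord y = z := by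
  funext n
  match n with
  | Int.ofNat n =>
    have h1 := h.block_eq_onWord 0 (n + 1)
    rw [h0] at h1
    simp only [Substitution.onBiWord]
    rw [List.getElem_of_eq h1.symm, getElem_block, zero_add]
    rfl
  | Int.negSucc n =>
    have h1 := h.block_eq_onWord (Int.negSucc n) (n + 1)
    have h2 := h.add_natCast (Int.negSucc n) (n + 1)
    rw [show Int.negSucc n + ((n + 1 : ℕ) : ℤ) = 0 by omega, h0] at h2
    have h3 := φ.le_onWord_block y (Int.negSucc n) (n + 1)
    simp only [Substitution.onBiWord]
    rw [List.getElem_of_eq h1.symm, getElem_block]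
    congr 1
    omega

theorem shift_right (h : IsParsing φ y z e) (m : ℤ) :
    IsParsing φ y (shift m z) (fun k => e k - m) where
  succ k := by rw [h.succ]; ring
  block_eq k := by rw [block_shift, sub_add_cancel, h.block_eq]

theorem shift_left (h : IsParsing φ y z e) (m : ℤ) :
    IsParsing φ (shift m y) z (fun k => e (k + m)) where
  succ k := by
    rw [show k + 1 + m = k + m + 1 by ring, h.succ]
    rfl
  block_eq k := h.block_eq (k + m)

theorem exists_eq_shift_onBiWord (h : IsParsing φ y z e) : z = shift (-(e 0)) (φ.onBiWord y) := by
  rw [(h.shift_right (e 0)).onBiWord_eq (sub_self _), shift_shift, neg_add_cancel, shift_zero]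

theorem factors_subset (h : IsParsing φ y z e) (h' : IsParsing φ y' z' e')
    (hf : factors y ⊆ factors y') : factors z ⊆ factors z' := by
  rw [factors_subset_iff] at hf ⊢
  intro i n
  obtain ⟨k, hk, -⟩ := exists_le_lt_succ h.lt_succ i
  obtain ⟨l, -, hl⟩ := exists_le_lt_succ h.lt_succ (i + n)
  have hkl : k < l + 1 := h.strictMono.lt_iff_lt.1 (by omega)
  obtain ⟨j, hj⟩ := hf k (l + 1 - k).toNat
  obtain ⟨-, h2⟩ := h.transfer h' hj
  rw [show k + (((l + 1 - k).toNat : ℕ) : ℤ) = l + 1 by omega] at h2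
  refine ⟨e' j + (i - e k), block_eq_iff.2 fun t h0 ht => ?_⟩
  have := h2 (i - e k + t) (by omega) (by omega)
  rwa [show e k + (i - e k + t) = i + t by ring, ← add_assoc] at this

end IsParsing

namespace Substitution

variable (φ : Substitution A B)

/-- The position at which `φ(y_k)` starts in `φ(y)`. -/
def cut (y : ℤ → A) : ℤ → ℤ
  | Int.ofNat k => (φ.onWord (block y 0 k)).length
  | Int.negSucc k => -((φ.onWord (block y (Int.negSucc k) (k + 1))).length : ℤ)

theorem cut_zero (y : ℤ → A) : φ.cut y 0 = 0 := by
  change ((φ.onWord (block y 0 0)).length : ℤ) = 0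
  simp [block, φ.onWord_nil]

theorem onBiWord_natCast_eq (y : ℤ → A) {n M : ℕ} (h : n + 1 ≤ M) :
    some (φ.onBiWord y n) = (φ.onWord (block y 0 M))[n]? := by
  obtain ⟨q, rfl⟩ := Nat.exists_eq_add_of_le h
  have h1 := φ.le_onWord_block y 0 (n + 1)
  rw [block_add, φ.onWord_append, List.getElem?_append_left (by omega),
    List.getElem?_eq_getElem (by omega)]
  rfl

theorem onBiWord_negSucc_eq (y : ℤ → A) {n M : ℕ} (h : n + 1 ≤ M) :
    some (φ.onBiWord y (Int.negSucc n)) =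
      (φ.onWord (block y (-M) M))[(φ.onWord (block y (-M) M)).length - (n + 1)]? := by
  obtain ⟨q, rfl⟩ := Nat.exists_eq_add_of_le' h
  have h1 := φ.le_onWord_block y (Int.negSucc n) (n + 1)
  rw [block_add, show -((q + (n + 1) : ℕ) : ℤ) + q = Int.negSucc n by omega, φ.onWord_append,
    List.length_append, List.getElem?_append_right (by omega),
    Nat.add_sub_assoc h1, Nat.add_sub_cancel_left, List.getElem?_eq_getElem (by omega)]
  rfl

theorem isParsing_onBiWord (y : ℤ → A) : IsParsing φ y (φ.onBiWord y) (φ.cut y) where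
  succ k := by
    match k with
    | Int.ofNat k =>
      change ((φ.onWord (block y 0 (k + 1))).length : ℤ) =
        ((φ.onWord (block y 0 k)).length : ℤ) + _
      rw [φ.onWord_block_succ_right]
      simp
    | Int.negSucc 0 =>
      change φ.cut y 0 = -((φ.onWord (block y (Int.negSucc 0) (0 + 1))).length : ℤ) + _
      rw [cut_zero, φ.onWord_block_succ_right]
      simp [block, φ.onWord_nil]
    | Int.negSucc (k + 1) =>
      change -((φ.onWord (block y (Int.negSucc k) (k + 1))).length : ℤ) =
        -((φ.onWord (block y (Int.negSucc (k + 1)) (k + 1 + 1))).length : ℤ) + _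
      rw [φ.onWord_block_succ_left _ _ (k + 1),
        show Int.negSucc (k + 1) + 1 = Int.negSucc k by omega]
      simp
  block_eq k := by
    apply List.ext_getElem (by simp)
    intro t h1 h2
    rw [getElem_block]
    apply Option.some_injective
    rw [← List.getElem?_eq_getElem h2]
    match k with
    | Int.ofNat k =>
      have hpos : φ.cut y (Int.ofNat k) + t = (((φ.onWord (block y 0 k)).length + t : ℕ) : ℤ) := by
        push_cast
        rfl
      have hM : ∃ M, k + 1 ≤ M ∧ (φ.onWord (block y 0 k)).length + t + 1 ≤ M :=
        ⟨max (k + 1) ((φ.onWord (block y 0 k)).length + t + 1), le_max_left _ _, le_max_right _ _⟩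
      obtain ⟨M, hM1, hM2⟩ := hM
      rw [hpos, φ.onBiWord_natCast_eq y hM2]
      obtain ⟨q, rfl⟩ := Nat.exists_eq_add_of_le hM1
      rw [block_add, φ.onWord_append, φ.onWord_block_succ_right, zero_add, List.append_assoc,
        List.getElem?_append_right (by omega), Nat.add_sub_cancel_left]
      exact List.getElem?_append_left h2
    | Int.negSucc k =>
      have hl := congrArg List.length (φ.onWord_block_succ_left y (Int.negSucc k) k)
      rw [List.length_append] at hl
      obtain ⟨n, hn⟩ : ∃ n, n + 1 + t = (φ.onWord (block y (Int.negSucc k) (k + 1))).length :=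
        ⟨(φ.onWord (block y (Int.negSucc k) (k + 1))).length - t - 1, by omega⟩
      have hpos : φ.cut y (Int.negSucc k) + t = Int.negSucc n := by
        change -((φ.onWord (block y (Int.negSucc k) (k + 1))).length : ℤ) + t = _
        omega
      obtain ⟨M, hM1, hM2⟩ : ∃ M, k + 1 ≤ M ∧ n + 1 ≤ M :=
        ⟨max (k + 1) (n + 1), le_max_left _ _, le_max_right _ _⟩
      rw [hpos, φ.onBiWord_negSucc_eq y hM2]
      obtain ⟨q, rfl⟩ := Nat.exists_eq_add_of_le' hM1
      rw [block_add, show -((q + (k + 1) : ℕ) : ℤ) + q = Int.negSucc k by omega, φ.onWord_append,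
        List.length_append, List.getElem?_append_right (by omega), φ.onWord_block_succ_left,
        List.getElem?_append_left (by rw [List.length_append]; omega)]
      congr 1
      rw [List.length_append]
      omega

theorem factors_onBiWord_subset {y y' : ℤ → A} (h : factors y ⊆ factors y') :
    factors (φ.onBiWord y) ⊆ factors (φ.onBiWord y') :=
  (φ.isParsing_onBiWord y).factors_subset (φ.isParsing_onBiWord y') h

theorem onBiWord_shift (y : ℤ → A) (m : ℤ) :
    φ.onBiWord (shift m y) = shift (φ.cut y m) (φ.onBiWord y) :=
  (((φ.isParsing_onBiWord y).shift_left m).shift_right (φ.cut y m)).onBiWord_eq (by simp)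

end Substitution

end Parsing

/-! ### Aperiodicity in the orbit closure of a preimage -/

section Aperiodic

variable {A B : Type*}

/-- Unrolling a periodic tail gives a periodic word in the orbit closure. -/
theorem IsEventuallyPeriodic.exists_periodic {z : ℤ → A} (hz : IsEventuallyPeriodic z) :
    ∃ (z' : ℤ → A) (p : ℤ), 0 < p ∧ shift p z' = z' ∧ factors z' ⊆ factors z := by
  rcases hz with ⟨N, p, hp, h⟩ | ⟨N, p, hp, h⟩
  · have hq : ∀ (q : ℕ) (m : ℤ), 0 ≤ m → z (N + (m + p * q)) = z (N + m) := by
      intro q m hm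
      induction q with
      | zero => simp
      | succ q ih =>
        have h1 : 0 ≤ p * q := by positivity
        rw [← ih, h (N + (m + p * q)) (by omega)]
        congr 1
        push_cast
        ring
    have hmod : ∀ m : ℤ, 0 ≤ m → z (N + m) = z (N + m % p) := by
      intro m hm
      rw [← hq (m / p).toNat (m % p) (Int.emod_nonneg _ hp.ne'),
        Int.toNat_of_nonneg (Int.ediv_nonneg hm hp.le), Int.emod_add_mul_ediv]
    refine ⟨fun n => z (N + n % p), p, hp, ?_, ?_⟩
    · funext n
      simp [shift]
    · rw [factors_subset_iff]
      intro i n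
      refine ⟨N + i % p, block_eq_iff.2 fun t h0 _ => ?_⟩
      rw [add_assoc, hmod (i % p + t) (by have := Int.emod_nonneg i hp.ne'; omega)]
      simp
  · have hq : ∀ (q : ℕ) (m : ℤ), 0 ≤ m → z (N - (m + p * q)) = z (N - m) := by
      intro q m hm
      induction q with
      | zero => simp
      | succ q ih =>
        have h1 : 0 ≤ p * q := by positivity
        rw [← ih, h (N - (m + p * q)) (by omega)]
        congr 1
        push_cast
        ring
    have hmod : ∀ m : ℤ, 0 ≤ m → z (N - m) = z (N - m % p) := by
      intro m hm
      rw [← hq (m / p).toNat (m % p) (Int.emod_nonneg _ hp.ne'),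
        Int.toNat_of_nonneg (Int.ediv_nonneg hm hp.le), Int.emod_add_mul_ediv]
    refine ⟨fun n => z (N - (-n) % p), p, hp, ?_, ?_⟩
    · funext n
      simp only [shift]
      rw [neg_add, ← sub_eq_add_neg, Int.sub_emod_right]
    · rw [factors_subset_iff]
      intro i n
      refine ⟨N - ((-i) % p + p * n), block_eq_iff.2 fun t h0 ht => ?_⟩
      have h1 : (n : ℤ) ≤ p * n := le_mul_of_one_le_left (by positivity) hp
      rw [sub_add, hmod ((-i) % p + p * n - t)
        (by have := Int.emod_nonneg (-i) hp.ne'; omega)]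
      congr 2
      rw [show (-i) % p + p * n - t = (-i) % p - t + p * n by ring, Int.add_mul_emod_self_left,
        Int.emod_sub_emod]
      congr 1
      ring

/-- If `φ(y)` is aperiodic and uniformly recurrent, then no word of the orbit closure of `y` is
eventually periodic: it would yield a periodic word with the same factors as `φ(y)`. -/
theorem IsAperiodic.of_factors_subset_preimage {φ : Substitution A B} {x : ℤ → B} {y z : ℤ → A}
    {m : ℤ} (hx : IsAperiodic x) (hu : IsUniformlyRecurrent x) (hxy : x = shift m (φ.onBiWord y))
    (hz : factors z ⊆ factors y) : IsAperiodic z := by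
  intro hper
  obtain ⟨z', p, hp, hzp, hf⟩ := hper.exists_periodic
  have h1 : factors (φ.onBiWord z') ⊆ factors x := by
    rw [hxy, factors_shift]
    exact φ.factors_onBiWord_subset (hf.trans hz)
  refine hx.ne_shift_of_factors_eq (hu.factors_eq h1) (q := φ.cut z' p) ?_ ?_
  · rw [← φ.cut_zero z']
    exact (φ.isParsing_onBiWord z').strictMono hp
  · rw [← φ.onBiWord_shift, hzp]

end Aperiodic

/-! ### A Sturmian word with a two-element string attractor -/

section SturmianAttractor

theorem IsSturmian.of_factors_subset {y z : ℤ → Fin 2} (hy : IsSturmian y) (hz : IsAperiodic z)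
    (h : factors z ⊆ factors y) : IsSturmian z ∧ factors y ⊆ factors z := by
  have hle : ∀ n, complexity y n ≤ complexity z n := fun n => by
    rw [hy.2 n]
    exact lt_complexity (fun h => hz (Or.inl h)) n
  have heq : ∀ n, factorsOfLength z n = factorsOfLength y n := fun n =>
    Set.eq_of_subset_of_ncard_le (factorsOfLength_mono h n) (hle n) (finite_factorsOfLength y n)
  refine ⟨⟨hz, fun n => ?_⟩, ?_⟩
  · rw [← hy.2 n]
    unfold complexity
    rw [heq]
  · rintro w ⟨n, hw⟩
    exact ⟨n, by rwa [heq]⟩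

/-- By compactness, some word of the orbit closure of `y` has a left half all of whose suffixes are
right special factors of `y`. -/
theorem exists_left_half_rightSpecial {A : Type*} [Finite A] {y : ℤ → A}
    (hy : ¬ IsPositivelyPeriodic y) :
    ∃ z : ℤ → A, factors z ⊆ factors y ∧ ∀ N : ℕ, ∃ i j, block y i N = block z (-N) N ∧
      block y j N = block z (-N) N ∧ y (i + N) ≠ y (j + N) := by
  let _ : TopologicalSpace A := ⊥
  have : DiscreteTopology A := ⟨rfl⟩
  choose i j hij hne using fun n => exists_rightSpecial (complexity_lt_complexity_succ hy n)
  obtain ⟨z, f, hf, hlim⟩ := CompactSpace.tendsto_subseq fun n : ℕ => shift (i n + n) y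
  have hev : ∀ a : ℤ, ∀ᶠ n in Filter.atTop, y (a + (i (f n) + f n)) = z a := by
    intro a
    have := (tendsto_pi_nhds.1 hlim) a
    rw [nhds_discrete, Filter.tendsto_pure] at this
    exact this
  have hblock : ∀ (a : ℤ) (N : ℕ), ∀ᶠ n in Filter.atTop,
      block y (a + (i (f n) + f n)) N = block z a N := by
    intro a N
    have h1 : ∀ᶠ n in Filter.atTop, ∀ t ∈ Finset.range N,
        y (a + t + (i (f n) + f n)) = z (a + t) :=
      (Filter.eventually_all_finset _).2 fun t _ => hev (a + t)
    filter_upwards [h1] with n hn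
    refine block_eq_iff.2 fun t h0 ht => ?_
    lift t to ℕ using h0
    rw [← hn t (Finset.mem_range.2 (by exact_mod_cast ht))]
    congr 1
    ring
  refine ⟨z, factors_subset_iff.2 fun a N => ?_, fun N => ?_⟩
  · obtain ⟨n, hn⟩ := (hblock a N).exists
    exact ⟨_, hn.symm⟩
  · obtain ⟨n, hn, hN⟩ := ((hblock (-N) N).and (Filter.eventually_ge_atTop N)).exists
    have hfn : N ≤ f n := hN.trans (hf.le_apply)
    refine ⟨i (f n) + f n - N, j (f n) + f n - N, ?_, ?_, ?_⟩
    · rw [← hn]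
      congr 1
      ring
    · rw [← hn]
      refine block_eq_iff.2 fun t h0 ht => ?_
      have := block_eq_iff.1 (hij (f n)) (f n - N + t) (by omega) (by omega)
      rw [show j (f n) + f n - N + t = j (f n) + (f n - N + t) by ring, ← this]
      congr 1
      ring
    · rw [sub_add_cancel, sub_add_cancel]
      exact hne (f n)

variable {z : ℤ → Fin 2}

/-- If a word `b` of length `N`, the left special factor of a Sturmian word, occurs at positions
`p < q < r` and its last two occurrences have different left extensions, then `N + 2 ≤ r - p`:
the factors of length `N + 1` starting in `[p, r)` are closed under taking predecessors, so that
they are all the factors of length `N + 1` to the left of `r`. -/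
theorem IsSturmian.add_two_le_sub (hz : IsSturmian z) {N : ℕ} {p q r : ℤ} (hpq : p < q)
    (hqr : q < r) (hpr' : block z p N = block z r N) (hqr' : block z q N = block z r N)
    (hne : z (q - 1) ≠ z (r - 1)) : (N : ℤ) + 2 ≤ r - p := by
  have hc : complexity z (N + 1) ≤ complexity z N + 1 := by rw [hz.2, hz.2]
  have hs : ∀ k, block z (k - 1) (N + 1) = z (k - 1) :: block z k N := fun k => by
    rw [block_succ_left, sub_add_cancel]
  have hspecial : ∀ m, block z m N = block z r N →
      ∃ k ∈ Set.Ico p r, block z (m - 1) (N + 1) = block z k (N + 1) := by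
    intro m hm
    have : z (m - 1) = z (q - 1) ∨ z (m - 1) = z (r - 1) := by
      revert hne
      generalize z (m - 1) = a
      generalize z (q - 1) = b
      generalize z (r - 1) = c
      revert a b c
      decide
    rcases this with h | h
    · exact ⟨q - 1, ⟨by omega, by omega⟩, by rw [hs, hs, h, hm, hqr']⟩
    · exact ⟨r - 1, ⟨by omega, by omega⟩, by rw [hs, hs, h, hm]⟩
  have hpred : ∀ m, (∃ k ∈ Set.Ico p r, block z m (N + 1) = block z k (N + 1)) →
      ∃ k ∈ Set.Ico p r, block z (m - 1) (N + 1) = block z k (N + 1) := by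
    rintro m ⟨k, ⟨hpk, hkr⟩, hk⟩
    have hk' : block z m N = block z k N := by
      rw [block_succ_right, block_succ_right] at hk
      exact List.append_inj_left hk (by simp)
    by_cases hl : z (m - 1) = z (k - 1)
    · rcases hpk.eq_or_lt with rfl | hpk
      · exact hspecial m (hk'.trans hpr')
      · exact ⟨k - 1, ⟨by omega, by omega⟩, by rw [hs, hs, hl, hk']⟩
    · exact hspecial m (leftSpecial_unique hc hqr'.symm hne.symm hk' hl)
  have hall : ∀ t : ℕ, ∃ k ∈ Set.Ico p r, block z (r - 1 - t) (N + 1) = block z k (N + 1) := by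
    intro t
    induction t with
    | zero => exact ⟨r - 1, ⟨by omega, by omega⟩, by simp⟩
    | succ t ih =>
      have := hpred _ ih
      rwa [sub_sub, ← Nat.cast_succ] at this
  have hsub : (fun i => block z i (N + 1)) '' Set.Iic (r - 1) ⊆
      (fun i => block z i (N + 1)) '' Set.Ico p r := by
    rintro _ ⟨i, hi, rfl⟩
    simp only [Set.mem_Iic] at hi
    obtain ⟨k, hk, h⟩ := hall (r - 1 - i).toNat
    rw [show r - 1 - (((r - 1 - i).toNat : ℕ) : ℤ) = i by omega] at h
    exact ⟨k, hk, h.symm⟩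
  have h1 := lt_ncard_image_block_Iic_of_not_isNegativelyPeriodic (x := z)
    (fun h => hz.1 (Or.inr h)) (r - 1) (N + 1)
  have h2 := Set.ncard_le_ncard hsub (finite_image_block z _ _)
  have h3 := Set.ncard_image_le (f := fun i => block z i (N + 1)) (Set.finite_Ico p r)
  rw [← Finset.coe_Ico, Set.ncard_coe_finset, Int.card_Ico, Finset.coe_Ico] at h3
  omega

/-- If every suffix of the left half of a Sturmian word `z` is right special, then the `n + 1`
blocks of length `n` meeting `{0, 1}` are pairwise distinct, hence exhaust the factors of
length `n`. -/
theorem IsSturmian.isStringAttractor (hz : IsSturmian z)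
    (hR : ∀ N : ℕ, ∃ i j, block z i N = block z (-N) N ∧ block z j N = block z (-N) N ∧
      z (i + N) ≠ z (j + N)) : IsStringAttractor z {0, 1} := by
  have hinj : ∀ (n : ℕ) (i j : ℤ), 1 - (n : ℤ) ≤ i → i < j → j ≤ 1 →
      block z i n ≠ block z j n := by
    intro n i j hi hij hj heq
    have hl : ∃ t : ℕ, z (i - 1 - t) ≠ z (j - 1 - t) := by
      by_contra! h
      refine hz.1 (Or.inr ⟨j - 1, j - i, by omega, fun k hk => ?_⟩)
      have := h (j - 1 - k).toNat
      rw [show j - 1 - (((j - 1 - k).toNat : ℕ) : ℤ) = k by omega,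
        show i - 1 - (((j - 1 - k).toNat : ℕ) : ℤ) = k - (j - i) by omega] at this
      exact this.symm
    have hr : ∃ s : ℕ, z (i + n + s) ≠ z (j + n + s) := by
      by_contra! h
      refine hz.1 (Or.inl ⟨i + n, j - i, by omega, fun k hk => ?_⟩)
      have := h (k - (i + n)).toNat
      rw [show i + n + (((k - (i + n)).toNat : ℕ) : ℤ) = k by omega,
        show j + n + (((k - (i + n)).toNat : ℕ) : ℤ) = k + (j - i) by omega] at this
      exact this
    classical
    obtain ⟨t, ht, htmin⟩ : ∃ t : ℕ, z (i - 1 - t) ≠ z (j - 1 - t) ∧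
        ∀ t' < t, z (i - 1 - t') = z (j - 1 - t') :=
      ⟨Nat.find hl, Nat.find_spec hl, fun t' h => not_not.1 (Nat.find_min hl h)⟩
    obtain ⟨s, hs, hsmin⟩ : ∃ s : ℕ, z (i + n + s) ≠ z (j + n + s) ∧
        ∀ s' < s, z (i + n + s') = z (j + n + s') :=
      ⟨Nat.find hr, Nat.find_spec hr, fun s' h => not_not.1 (Nat.find_min hr h)⟩
    -- the maximal common extension of the two blocks is bispecial
    have hB : block z (i - t) (t + n + s) = block z (j - t) (t + n + s) := by
      refine block_eq_iff.2 fun u h0 hu => ?_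
      push_cast at hu
      rcases lt_or_ge u t with h1 | h1
      · have := htmin (t - 1 - u).toNat (by omega)
        rw [show i - 1 - (((t - 1 - u : ℤ).toNat : ℕ) : ℤ) = i - t + u by omega,
          show j - 1 - (((t - 1 - u : ℤ).toNat : ℕ) : ℤ) = j - t + u by omega] at this
        exact this
      rcases lt_or_ge u (t + n) with h2 | h2
      · have := block_eq_iff.1 heq (u - t) (by omega) (by omega)
        rw [show i + (u - t) = i - t + u by ring, show j + (u - t) = j - t + u by ring] at this
        exact this
      · have := hsmin (u - t - n).toNat (by omega)
        rw [show i + n + (((u - t - n : ℤ).toNat : ℕ) : ℤ) = i - t + u by omega,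
          show j + n + (((u - t - n : ℤ).toNat : ℕ) : ℤ) = j - t + u by omega] at this
        exact this
    obtain ⟨i', j', hi', hj', hne⟩ := hR (t + n + s)
    have hc : complexity z (t + n + s + 1) ≤ complexity z (t + n + s) + 1 := by rw [hz.2, hz.2]
    -- it is right special, so it also ends at the origin
    have hR' := (rightSpecial_unique hc (hi'.trans hj'.symm) hne hB (by
      rw [show i - t + ((t + n + s : ℕ) : ℤ) = i + n + s by push_cast; ring,
        show j - t + ((t + n + s : ℕ) : ℤ) = j + n + s by push_cast; ring]
      exact hs)).1
    have := hz.add_two_le_sub (N := t + n + s) (p := -((t + n + s : ℕ) : ℤ)) (q := i - t)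
      (r := j - t) (by push_cast; omega) (by omega) (by rw [← hi', ← hR', hB]) hB (by
        rw [show i - t - 1 = i - 1 - t by ring, show j - t - 1 = j - 1 - t by ring]
        exact ht)
    push_cast at this
    omega
  rintro w ⟨n, hw⟩ hne
  have hn : w.length = n := by
    obtain ⟨i, rfl⟩ := hw
    simp
  have hn0 : 0 < n := by
    rw [← hn]
    exact List.length_pos_iff.2 hne
  have hinjOn : Set.InjOn (fun i => block z i n) (Set.Icc (1 - (n : ℤ)) 1) := by
    intro i hi j hj hij
    rcases lt_trichotomy i j with h | h | h
    · exact absurd hij (hinj n i j hi.1 h hj.2)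
    · exact h
    · exact absurd hij.symm (hinj n j i hj.1 h hi.2)
  have hsurj : (fun i => block z i n) '' Set.Icc (1 - (n : ℤ)) 1 = factorsOfLength z n := by
    refine Set.eq_of_subset_of_ncard_le (by rintro _ ⟨i, -, rfl⟩; exact ⟨i, rfl⟩) ?_
      (finite_factorsOfLength z n)
    rw [hinjOn.ncard_image, ← Finset.coe_Icc, Set.ncard_coe_finset, Int.card_Icc]
    have := hz.2 n
    unfold complexity at this
    omega
  rw [← hsurj] at hw
  obtain ⟨i, ⟨h1, h2⟩, rfl⟩ := hw
  refine ⟨i, by simp, ?_⟩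
  rw [length_block]
  rcases h2.eq_or_lt with rfl | h2
  · exact ⟨1, ⟨le_rfl, by omega⟩, by simp⟩
  · exact ⟨0, ⟨by omega, by omega⟩, by simp⟩

theorem IsSturmian.exists_isStringAttractor {y : ℤ → Fin 2} (hy : IsSturmian y)
    (h : ∀ z, factors z ⊆ factors y → IsAperiodic z) :
    ∃ z, factors z ⊆ factors y ∧ IsStringAttractor z {0, 1} := by
  obtain ⟨z, hzy, hR⟩ := exists_left_half_rightSpecial fun h => hy.1 (Or.inl h)
  obtain ⟨hz, hyz⟩ := hy.of_factors_subset (h z hzy) hzy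
  refine ⟨z, hzy, hz.isStringAttractor fun N => ?_⟩
  obtain ⟨i, j, hi, hj, hne⟩ := hR N
  obtain ⟨i', hi'⟩ := factors_subset_iff.1 hyz i (N + 1)
  obtain ⟨j', hj'⟩ := factors_subset_iff.1 hyz j (N + 1)
  rw [block_succ_right, block_succ_right] at hi' hj'
  have hi2 := List.append_inj hi' (by simp)
  have hj2 := List.append_inj hj' (by simp)
  simp only [List.cons.injEq, and_true] at hi2 hj2
  exact ⟨i', j', hi2.1.symm.trans hi, hj2.1.symm.trans hj, by rwa [← hi2.2, ← hj2.2]⟩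

end SturmianAttractor

/-! ### String attractors, span and complexity -/

section Span

variable {A B : Type*}

/-- The positions of `φ(y_0)φ(y_1)` form a string attractor of `φ(y)` when `{0, 1}` is one
of `y`. -/
theorem IsStringAttractor.onBiWord (φ : Substitution A B) {y : ℤ → A}
    (h : IsStringAttractor y {0, 1}) :
    IsStringAttractor (φ.onBiWord y) (Set.Ico 0 (φ.cut y 2)) := by
  have hp := φ.isParsing_onBiWord y
  have hmono := hp.strictMono
  rintro _ ⟨n, i, rfl⟩ hne
  have hn : 0 < n := by simpa using List.length_pos_iff.2 hne
  obtain ⟨k, hk, hk'⟩ := exists_le_lt_succ hp.lt_succ i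
  obtain ⟨l, hl, hl'⟩ := exists_le_lt_succ hp.lt_succ (i + n - 1)
  have hkl : k < l + 1 := hmono.lt_iff_lt.1 (by omega)
  obtain ⟨N, rfl⟩ : ∃ N : ℕ, l = k + N := ⟨(l - k).toNat, by omega⟩
  obtain ⟨k', hb, c, hc, hc'⟩ := h (block y k (N + 1)) (block_mem_factors _ _ _) (by
    simp [← List.length_pos_iff])
  rw [length_block] at hb hc
  have h1 := hp.transfer hp hb
  have h2 : φ.cut y (k' + 1) - φ.cut y k' = φ.cut y (k + 1) - φ.cut y k :=
    (hp.transfer hp (n := 1) (k := k') (k' := k) (by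
      rw [block_succ_left, block_succ_left y k] at hb
      rw [block_one, block_one, (List.cons_eq_cons.1 hb).1])).1
  have h3 : φ.cut y (k' + N) - φ.cut y k' = φ.cut y (k + N) - φ.cut y k :=
    (hp.transfer hp (n := N) (k := k') (k' := k) (by
      rw [block_succ_right, block_succ_right] at hb
      exact List.append_inj_left hb (by simp))).1
  push_cast at h1 hc
  rw [← add_assoc, ← add_assoc] at h1
  refine ⟨φ.cut y k' + (i - φ.cut y k), ?_, ?_⟩
  · rw [length_block, block_eq_iff]
    intro t h0 ht
    rw [add_assoc, h1.2 (i - φ.cut y k + t) (by omega) (by omega)]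
    congr 1
    ring
  · rw [length_block]
    have hc1 : φ.cut y c ≤ φ.cut y (k' + N) := hmono.monotone (by have := hc.2; omega)
    have hc2 : φ.cut y (k' + 1) ≤ φ.cut y (c + 1) := hmono.monotone (by have := hc.1; omega)
    have hc3 : 0 ≤ φ.cut y c := by
      rw [← φ.cut_zero y]
      exact hmono.monotone (by rcases hc' with rfl | rfl <;> norm_num)
    have hc4 : φ.cut y (c + 1) ≤ φ.cut y 2 :=
      hmono.monotone (by rcases hc' with rfl | rfl <;> norm_num)
    have hc5 := hp.lt_succ c
    refine ⟨max (φ.cut y k' + (i - φ.cut y k)) (φ.cut y c), ⟨le_max_left _ _, ?_⟩, ?_, ?_⟩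
    · exact max_lt (by omega) (by omega)
    · exact hc3.trans (le_max_right _ _)
    · exact max_lt (by omega) (by omega)

theorem IsStringAttractor.nonempty {x : ℤ → A} {Γ : Set ℤ} (h : IsStringAttractor x Γ) :
    Γ.Nonempty := by
  obtain ⟨i, -, c, -, hc⟩ := h (block x 0 1) (block_mem_factors _ _ _) (by simp [block_one])
  exact ⟨c, hc⟩

theorem hasFiniteSpan_iff {x : ℤ → A} :
    HasFiniteSpan x ↔ ∃ a b : ℤ, IsStringAttractor x (Set.Icc a b) := by
  unfold HasFiniteSpan wordSpan
  simp only [iInf_lt_iff, Set.mem_ofPred_eq]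
  constructor
  · rintro ⟨Γ, hΓ, hspan⟩
    obtain ⟨c, hc⟩ := hΓ.nonempty
    have hsup : ((c : ℝ) : EReal) ≤ ⨆ n ∈ Γ, ((n : ℝ) : EReal) := le_iSup₂_of_le c hc le_rfl
    have hinf : ⨅ n ∈ Γ, ((n : ℝ) : EReal) ≤ ((c : ℝ) : EReal) := iInf₂_le c hc
    unfold setSpan at hspan
    have hsup' : ⨆ n ∈ Γ, ((n : ℝ) : EReal) ≠ ⊤ := by
      intro h
      rw [h, EReal.top_sub] at hspan
      · exact lt_irrefl _ hspan
      · exact (hinf.trans_lt (EReal.coe_lt_top _)).ne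
    have hinf' : ⨅ n ∈ Γ, ((n : ℝ) : EReal) ≠ ⊥ := by
      intro h
      rw [h, EReal.sub_bot] at hspan
      · exact lt_irrefl _ hspan
      · exact ((EReal.bot_lt_coe _).trans_le hsup).ne'
    obtain ⟨b, hb⟩ := EReal.lt_iff_exists_real_btwn.1 (lt_top_iff_ne_top.2 hsup')
    obtain ⟨a, ha⟩ := EReal.lt_iff_exists_real_btwn.1 (bot_lt_iff_ne_bot.2 hinf')
    refine ⟨⌊a⌋, ⌈b⌉, fun w hw hne => ?_⟩
    obtain ⟨i, hi, d, hd, hdΓ⟩ := hΓ w hw hne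
    refine ⟨i, hi, d, hd, ?_, ?_⟩
    · have h1 : (a : EReal) < ((d : ℝ) : EReal) := ha.2.trans_le (iInf₂_le d hdΓ)
      have h2 : a < d := by exact_mod_cast h1
      exact_mod_cast (Int.floor_le a).trans h2.le
    · have h1 : ((d : ℝ) : EReal) < (b : EReal) :=
        (le_iSup₂_of_le (f := fun (n : ℤ) (_ : n ∈ Γ) => ((n : ℝ) : EReal)) d hdΓ le_rfl).trans_lt
          hb.1
      have h2 : (d : ℝ) < b := by exact_mod_cast h1
      exact_mod_cast h2.le.trans (Int.le_ceil b)
  · rintro ⟨a, b, h⟩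
    refine ⟨_, h, ?_⟩
    unfold setSpan
    have h1 : (⨆ n ∈ Set.Icc a b, ((n : ℝ) : EReal)) ≤ ((b : ℝ) : EReal) :=
      iSup₂_le fun n hn => by exact_mod_cast hn.2
    have h2 : ((a : ℝ) : EReal) ≤ ⨅ n ∈ Set.Icc a b, ((n : ℝ) : EReal) :=
      le_iInf₂ fun n hn => by exact_mod_cast hn.1
    exact (EReal.sub_le_sub h1 h2).trans_lt (by
      rw [← EReal.coe_sub]
      exact EReal.coe_lt_top _)

/-- An attractor in `[a, b]` meets at most `n + (b - a)` blocks of length `n`. -/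
theorem IsStringAttractor.complexity_le {x : ℤ → A} {a b : ℤ}
    (h : IsStringAttractor x (Set.Icc a b)) {n : ℕ} (hn : 0 < n) :
    complexity x n ≤ n + (b - a).toNat := by
  have hab : a ≤ b := Set.nonempty_Icc.1 h.nonempty
  have hsub : factorsOfLength x n ⊆ (fun i => block x i n) '' Set.Icc (a - n + 1) b := by
    rintro w ⟨i, rfl⟩
    obtain ⟨j, hj, c, ⟨hc1, hc2⟩, hc3, hc4⟩ := h _ (block_mem_factors x i n)
      (by rw [← List.length_pos_iff]; simpa using hn)
    rw [length_block] at hj hc2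
    exact ⟨j, ⟨by omega, by omega⟩, hj⟩
  have h1 := Set.ncard_le_ncard hsub ((Set.finite_Icc _ _).image _)
  have h2 := Set.ncard_image_le (f := fun i => block x i n) (Set.finite_Icc (a - n + 1) b)
  rw [← Finset.coe_Icc, Set.ncard_coe_finset, Int.card_Icc, Finset.coe_Icc] at h2
  unfold complexity
  omega

/-- For aperiodic words `p(n) - n` is positive and nondecreasing, so it is eventually constant as soon
as it is bounded. -/
theorem IsAperiodic.isQuasiSturmian [Finite A] {x : ℤ → A} (hx : IsAperiodic x) {C : ℕ}
    (h : ∀ n, 0 < n → complexity x n ≤ n + C) : IsQuasiSturmian x := by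
  refine ⟨hx, ?_⟩
  have hx' : ¬ IsPositivelyPeriodic x := fun h => hx (Or.inl h)
  have hlt := lt_complexity hx'
  have hmono : Monotone fun n => complexity x n - n := monotone_nat_of_le_succ fun n => by
    have h1 := complexity_lt_complexity_succ hx' n
    omega
  have hbdd : (Set.range fun n => complexity x n - n).Finite := by
    refine (Set.finite_Iic (max C (complexity x 0))).subset ?_
    rintro _ ⟨n, rfl⟩
    rcases Nat.eq_zero_or_pos n with rfl | hn
    · exact Set.mem_Iic.2 (le_max_right _ _)
    · exact (Nat.sub_le_iff_le_add'.2 (h n hn)).trans (le_max_left _ _)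
  obtain ⟨_, ⟨n₀, rfl⟩, hmax⟩ := Set.exists_max_image _ id hbdd (Set.range_nonempty _)
  refine ⟨n₀, complexity x n₀ - n₀, by have := hlt n₀; omega, fun n hn => ?_⟩
  have h1 := hmono hn
  have h2 := hmax _ ⟨n, rfl⟩
  have h3 := hlt n
  simp only [id] at h1 h2
  omega

end Span

/-! ### Return morphisms are acyclic -/

theorem IsReturnMorphism.isAcyclic {B : Type*} {φ : Substitution (Fin 2) B}
    (h : IsReturnMorphism φ) : IsAcyclic φ := by
  obtain ⟨w, -, hinj, hocc⟩ := h
  -- if `φ(a) = uⁱ` and `φ(b) = uʲ` with `i < j`, then `w` occurs in `w φ(b)` at position `|φ(a)|`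
  have key : ∀ (a b : Fin 2) (u : FreeMonoid B) (i j : ℕ), a ≠ b → i ≤ j →
      φ.onLetter a = (u ^ i).toList → φ.onLetter b = (u ^ j).toList → False := by
    intro a b u i j hab hij ha hb
    obtain ⟨d, rfl⟩ := Nat.exists_eq_add_of_le hij
    have hb' : φ.onLetter b = φ.onLetter a ++ (u ^ d).toList := by
      rw [hb, pow_add, FreeMonoid.toList_mul, ha]
    have h1 : (φ.onLetter a).length ∈ occurrences w (w ++ φ.onLetter a) := by
      rw [hocc]
      simp
    obtain ⟨p, s, hps, hp⟩ := h1
    have h2 : (φ.onLetter a).length ∈ occurrences w (w ++ φ.onLetter b) :=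
      ⟨p, s ++ (u ^ d).toList, by rw [hb', ← List.append_assoc, hps, List.append_assoc], hp⟩
    rw [hocc] at h2
    have hpos := φ.length_onLetter_pos a
    rcases h2 with h2 | h2
    · omega
    · have h2 : (φ.onLetter a).length = (φ.onLetter b).length := h2
      rw [hb', List.length_append] at h2
      have h3 : (u ^ d).toList = [] := List.length_eq_zero_iff.1 (by omega)
      rw [h3, List.append_nil] at hb'
      exact hab (hinj hb'.symm)
  rintro ⟨u, i, j, h0, h1⟩
  rcases le_total i j with h | h
  · exact key 0 1 u i j (by decide) h (congrArg FreeMonoid.toList h0)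
      (congrArg FreeMonoid.toList h1)
  · exact key 1 0 u j i (by decide) h (congrArg FreeMonoid.toList h1)
      (congrArg FreeMonoid.toList h0)

/-! ### Derivation with respect to a right special factor -/

section Derivation

variable {A B : Type*}

/-- The substitution with prescribed non-empty images of the letters. -/
def Substitution.ofLetters (r : A → List B) (hr : ∀ a, r a ≠ []) : Substitution A B where
  hom := FreeMonoid.lift fun a => FreeMonoid.ofList (r a)
  nonerasing u := by
    induction u using FreeMonoid.casesOn with
    | one => simp
    | of_mul a u =>
      intro _ h
      rw [map_mul, FreeMonoid.lift_eval_of] at h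
      have h' : r a ++ (FreeMonoid.lift (fun a => FreeMonoid.ofList (r a)) u).toList = [] := h
      exact hr a (List.append_eq_nil_iff.1 h').1

@[simp]
theorem Substitution.onLetter_ofLetters (r : A → List B) (hr : ∀ a, r a ≠ []) (a : A) :
    (Substitution.ofLetters r hr).onLetter a = r a := by
  change (FreeMonoid.lift (fun a => FreeMonoid.ofList (r a)) (FreeMonoid.of a)).toList = r a
  rw [FreeMonoid.lift_eval_of, FreeMonoid.toList_ofList]

/-- The map `e` lists in increasing order the positions at which the word `w` of length `n`
occurs in `x`. -/
structure EnumeratesOccurrences (x : ℤ → A) (n : ℕ) (w : List A) (e : ℤ → ℤ) : Prop where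
  block_eq : ∀ k, block x (e k) n = w
  lt_succ : ∀ k, e k < e (k + 1)
  block_ne : ∀ k t, e k < t → t < e (k + 1) → block x t n ≠ w

namespace EnumeratesOccurrences

variable {x : ℤ → A} {n : ℕ} {w : List A} {e : ℤ → ℤ}

theorem exists_eq (h : EnumeratesOccurrences x n w e) {t : ℤ} (ht : block x t n = w) :
    ∃ k, e k = t := by
  obtain ⟨k, h1, h2⟩ := exists_le_lt_succ h.lt_succ t
  rcases h1.eq_or_lt with h1 | h1
  · exact ⟨k, h1⟩
  · exact absurd ht (h.block_ne k t h1 h2)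

/-- If `w` is the only right special factor of its length, a return word to `w` is determined by
its first letter. -/
theorem return_eq (h : EnumeratesOccurrences x n w e)
    (hw : ∀ i j, block x i n = block x j n → x (i + n) ≠ x (j + n) → block x i n = w) {k l : ℤ}
    (hkl : x (e k + n) = x (e l + n)) :
    e (k + 1) - e k = e (l + 1) - e l ∧
      ∀ t, 0 ≤ t → t < e (k + 1) - e k → x (e k + n + t) = x (e l + n + t) := by
  have hletter : ∀ t : ℕ, t < e (k + 1) - e k → t < e (l + 1) - e l →
      block x (e k + t) n = block x (e l + t) n → x (e k + t + n) = x (e l + t + n) := by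
    intro t hk _ hb
    rcases Nat.eq_zero_or_pos t with rfl | ht
    · simpa using hkl
    · by_contra hne
      exact h.block_ne k (e k + t) (by omega) (by omega) (hw _ _ hb hne)
  have hblock : ∀ t : ℕ, t ≤ e (k + 1) - e k → t ≤ e (l + 1) - e l →
      block x (e k + t) n = block x (e l + t) n := by
    intro t
    induction t with
    | zero => intro _ _; simp [h.block_eq]
    | succ t ih =>
      intro h1 h2
      push_cast at h1 h2
      have hb := ih (by omega) (by omega)
      have hb' : block x (e k + t) (n + 1) = block x (e l + t) (n + 1) := by
        rw [block_succ_right, block_succ_right, hb, hletter t (by omega) (by omega) hb]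
      rw [block_succ_left, block_succ_left] at hb'
      push_cast
      rw [← add_assoc, ← add_assoc]
      exact (List.cons_eq_cons.1 hb').2
  have hgap : e (k + 1) - e k = e (l + 1) - e l := by
    have h1 := h.lt_succ k
    have h2 := h.lt_succ l
    rcases lt_trichotomy (e (k + 1) - e k) (e (l + 1) - e l) with hlt | heq | hlt
    · exfalso
      have hb := hblock (e (k + 1) - e k).toNat (by omega) (by omega)
      rw [show e k + (((e (k + 1) - e k).toNat : ℕ) : ℤ) = e (k + 1) by omega, h.block_eq] at hb
      exact h.block_ne l _ (by omega) (by omega) hb.symm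
    · exact heq
    · exfalso
      have hb := hblock (e (l + 1) - e l).toNat (by omega) (by omega)
      rw [show e l + (((e (l + 1) - e l).toNat : ℕ) : ℤ) = e (l + 1) by omega, h.block_eq] at hb
      exact h.block_ne k _ (by omega) (by omega) hb
  refine ⟨hgap, fun t h0 ht => ?_⟩
  lift t to ℕ using h0
  rw [add_right_comm, add_right_comm (e l)]
  exact hletter t ht (by omega) (hblock t ht.le (by omega))

/-- Two equal blocks ending with an occurrence of `w`, the first of which begins with an
occurrence of `w`, contain occurrences of `w` at the same places. -/
theorem eq_add_sub (h : EnumeratesOccurrences x n w e) {i i' P : ℤ} {N M : ℕ}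
    (hP : e (i' + N) = P + (e (i + N) - e i)) (hM : (M : ℤ) = n + (e (i + N) - e i))
    (hb : block x P M = block x (e i) M) (s : ℕ) (hs : s ≤ N) :
    e (i' + N - s) = P + (e (i + N - s) - e i) := by
  have hmono : StrictMono e := strictMono_int_of_lt_succ h.lt_succ
  have htrans : ∀ o : ℤ, 0 ≤ o → o + n ≤ M → block x (P + o) n = block x (e i + o) n := by
    intro o h0 h1
    refine block_eq_iff.2 fun t ht ht' => ?_
    rw [add_assoc, add_assoc]
    exact block_eq_iff.1 hb (o + t) (by omega) (by omega)
  induction s with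
  | zero => simpa using hP
  | succ s ih =>
    have ih := ih (by omega)
    have hi : i ≤ i + N - (s + 1 : ℕ) := by omega
    have h1 := hmono.monotone hi
    have h2 : e (i + N - s) ≤ e (i + N) := hmono.monotone (by omega)
    have h3 := h.lt_succ (i + N - (s + 1 : ℕ))
    have h4 := h.lt_succ (i' + N - (s + 1 : ℕ))
    have h5 := h.block_ne (i + N - (s + 1 : ℕ))
    have h6 := h.block_ne (i' + N - (s + 1 : ℕ))
    rw [show i + N - ((s + 1 : ℕ) : ℤ) + 1 = i + N - s by push_cast; ring] at h3 h5
    rw [show i' + N - ((s + 1 : ℕ) : ℤ) + 1 = i' + N - s by push_cast; ring] at h4 h6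
    rcases lt_trichotomy (e (i' + N - (s + 1 : ℕ))) (P + (e (i + N - (s + 1 : ℕ)) - e i))
      with hlt | heq | hlt
    · exfalso
      refine h6 _ hlt (by omega) ?_
      rw [htrans _ (by omega) (by omega), add_sub_cancel, h.block_eq]
    · exact heq
    · exfalso
      refine h5 (e i + (e (i' + N - (s + 1 : ℕ)) - P)) (by omega) (by omega) ?_
      rw [← htrans _ (by omega) (by omega), add_sub_cancel, h.block_eq]

end EnumeratesOccurrences

theorem complexity_succ_le_of_rightSpecial_unique {y : ℤ → Fin 2} {N : ℕ}
    (h : ∀ i j i' j', block y i N = block y j N → y (i + N) ≠ y (j + N) →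
      block y i' N = block y j' N → y (i' + N) ≠ y (j' + N) → block y i' N = block y i N) :
    complexity y (N + 1) ≤ complexity y N + 1 := by
  unfold complexity
  rw [← take_image_factorsOfLength y N]
  refine ncard_le_ncard_image_add_one (finite_factorsOfLength y _) ?_
  rintro _ ⟨i, rfl⟩ _ ⟨j, rfl⟩ _ ⟨i', rfl⟩ _ ⟨j', rfl⟩
  simp only [block_succ_right]
  rw [List.take_left' (by simp), List.take_left' (by simp), List.take_left' (by simp),
    List.take_left' (by simp)]
  intro hne hne' hij hij'
  rw [hij] at hne
  rw [hij'] at hne'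
  simp only [ne_eq, List.append_cancel_left_eq, List.cons.injEq, and_true] at hne hne'
  have hii' := h i j i' j' hij hne hij' hne'
  have hletter : y (i' + N) = y (i + N) ∨ y (i' + N) = y (j + N) := by
    revert hne
    generalize y (i' + N) = a
    generalize y (i + N) = b
    generalize y (j + N) = c
    revert a b c
    decide
  exact hletter.imp (fun h => by rw [h, hii']) fun h => by rw [h, hii', hij]

/-- The occurrences of a right special factor `w` cut `x` into return words to `w`. When `w`
is so long that there is a single right special factor of each length at least `|w|`, there are two
return words, and coding them by letters yields a Sturmian word `y`: if `u` is right special in `y`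
then `w φ(u)` is right special in `x`. -/
theorem IsQuasiSturmian.exists_isReturnMorphism [Finite A] {x : ℤ → A} (hx : IsQuasiSturmian x)
    (hu : IsUniformlyRecurrent x) :
    ∃ (φ : Substitution (Fin 2) A) (m : ℤ) (y : ℤ → Fin 2),
      IsReturnMorphism φ ∧ IsSturmian y ∧ x = shift m (φ.onBiWord y) := by
  obtain ⟨hap, n₀, K, -, hcompl⟩ := hx
  obtain ⟨n, hn₀, hn⟩ : ∃ n, n₀ ≤ n ∧ 0 < n := ⟨n₀ + 1, by omega, by omega⟩
  have hc : ∀ N ≥ n, complexity x (N + 1) ≤ complexity x N + 1 := fun N hN => by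
    rw [hcompl N (by omega), hcompl (N + 1) (by omega)]
    omega
  obtain ⟨i₀, j₀, hij₀, hne₀⟩ := exists_rightSpecial
    (complexity_lt_complexity_succ (fun h => hap (Or.inl h)) n)
  obtain ⟨w, hw₀⟩ : ∃ w, block x i₀ n = w := ⟨_, rfl⟩
  have hspec : ∀ i j, block x i n = block x j n → x (i + n) ≠ x (j + n) → block x i n = w :=
    fun i j hij hne => ((rightSpecial_unique (hc n le_rfl) hij₀ hne₀ hij hne).1).trans hw₀
  obtain ⟨e, he⟩ : ∃ e, EnumeratesOccurrences x n w e := by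
    obtain ⟨m, hm⟩ := hu.exists_block_eq_mem_Ico i₀ n
    obtain ⟨e, h1, h2, h3⟩ := exists_enumeration (O := {t | block x t n = w})
      (fun c => by
        obtain ⟨j, hj, -, hj'⟩ := hm (c + 1)
        exact ⟨j, hj'.trans hw₀, by omega⟩)
      (fun c => by
        obtain ⟨j, -, hj, hj'⟩ := hm (c - m)
        exact ⟨j, hj'.trans hw₀, by omega⟩)
    exact ⟨e, h1, h2, h3⟩
  have hmono : StrictMono e := strictMono_int_of_lt_succ he.lt_succ
  have hletter : ∀ k, x (e k + n) = x (i₀ + n) ∨ x (e k + n) = x (j₀ + n) := by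
    intro k
    by_contra! h
    have h1 := (rightSpecial_unique (i' := e k) (j' := i₀) (hc n le_rfl) hij₀ hne₀
      ((he.block_eq k).trans hw₀.symm) h.1).2
    tauto
  classical
  let y : ℤ → Fin 2 := fun k => if x (e k + n) = x (i₀ + n) then 0 else 1
  have hy : ∀ k l, y k = y l ↔ x (e k + n) = x (e l + n) := by
    intro k l
    simp only [y]
    constructor
    · intro h
      rcases hletter k with hk | hk <;> rcases hletter l with hl | hl <;>
        simp_all [Ne.symm hne₀]
    · intro h
      rw [h]
  obtain ⟨k₀, hk₀⟩ := he.exists_eq hw₀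
  obtain ⟨k₁, hk₁⟩ := he.exists_eq (hij₀.symm.trans hw₀)
  have hκ : ∀ c : Fin 2, ∃ k, y k = c := by
    intro c
    match c with
    | 0 => exact ⟨k₀, by simp [y, hk₀]⟩
    | 1 => exact ⟨k₁, by simp [y, hk₁, Ne.symm hne₀]⟩
  choose κ hκ using hκ
  let r : Fin 2 → List A := fun c => block x (e (κ c) + n) (e (κ c + 1) - e (κ c)).toNat
  have hr : ∀ c, ∃ l, r c = x (e (κ c) + n) :: l := by
    intro c
    obtain ⟨g, hg⟩ : ∃ g, (e (κ c + 1) - e (κ c)).toNat = g + 1 :=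
      ⟨(e (κ c + 1) - e (κ c)).toNat - 1, by have := he.lt_succ (κ c); omega⟩
    exact ⟨block x (e (κ c) + n + 1) g, by simp only [r, hg, block_succ_left]⟩
  let φ : Substitution (Fin 2) A := Substitution.ofLetters r fun c h => by
    obtain ⟨l, hl⟩ := hr c
    rw [h] at hl
    exact absurd hl (by simp)
  have hφ : ∀ c, φ.onLetter c = r c := Substitution.onLetter_ofLetters r _
  have hlen : ∀ c, ((r c).length : ℤ) = e (κ c + 1) - e (κ c) := fun c => by
    have := he.lt_succ (κ c)
    simp only [r, length_block]
    omega
  have hret := fun k => he.return_eq hspec ((hy k (κ (y k))).1 (hκ _).symm)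
  have hp : IsParsing φ y x fun k => e k + n := by
    refine ⟨fun k => ?_, fun k => ?_⟩
    · rw [hφ, hlen, ← (hret k).1]
      ring
    · rw [hφ]
      simp only [r, length_block]
      refine block_eq_iff.2 fun t h0 ht => (hret k).2 t h0 ?_
      have := (hret k).1
      omega
  have hxy := hp.exists_eq_shift_onBiWord
  have hyap : IsAperiodic y := hap.of_factors_subset_preimage hu hxy subset_rfl
  refine ⟨φ, _, y, ⟨w, ?_, ?_, ?_⟩, ⟨hyap, ?_⟩, hxy⟩
  · rw [← hw₀, ← List.length_pos_iff]
    simpa using hn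
  · intro c d hcd
    rw [hφ, hφ] at hcd
    obtain ⟨l, hl⟩ := hr c
    obtain ⟨l', hl'⟩ := hr d
    rw [hl, hl'] at hcd
    rw [← hκ c, ← hκ d, hy]
    exact (List.cons_eq_cons.1 hcd).1
  · intro c
    have h1 := hlen c
    have h2 : w ++ φ.onLetter c = block x (e (κ c)) (n + (r c).length) := by
      rw [block_add, he.block_eq, hφ]
      simp only [r, length_block]
    have hwn : w.length = n := by simp [← hw₀]
    ext t
    rw [h2, hφ, mem_occurrences_block_iff, hwn]
    simp only [Set.mem_insert_iff, Set.mem_singleton_iff]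
    constructor
    · rintro ⟨h3, h4⟩
      by_contra! h5
      exact he.block_ne (κ c) (e (κ c) + t) (by omega) (by omega) h4
    · rintro (rfl | rfl)
      · exact ⟨by omega, by simp [he.block_eq]⟩
      · exact ⟨by omega, by rw [h1, add_sub_cancel, he.block_eq]⟩
  · have hunique : ∀ N i j i' j', block y i N = block y j N → y (i + N) ≠ y (j + N) →
        block y i' N = block y j' N → y (i' + N) ≠ y (j' + N) →
        e (i + N) - e i ≤ e (i' + N) - e i' → block y i' N = block y i N := by
      intro N i j i' j' hij hne hij' hne' hle
      -- two occurrences of a factor `u` of `y` give two occurrences of `w φ(u)` in `x`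
      have hext : ∀ k l, block y k N = block y l N → e (k + N) - e k = e (l + N) - e l ∧
          ∀ t, 0 ≤ t → t < n + (e (k + N) - e k) → x (e k + t) = x (e l + t) := by
        intro k l hkl
        have h1 := hp.transfer hp hkl
        simp only [add_sub_add_right_eq_sub] at h1
        refine ⟨h1.1, fun t h0 ht => ?_⟩
        rcases lt_or_ge t n with h2 | h2
        · exact block_eq_iff.1 ((he.block_eq k).trans (he.block_eq l).symm) t h0 h2
        · have := h1.2 (t - n) (by omega) (by omega)
          rwa [add_assoc, add_assoc, add_sub_cancel] at this
      have hD : 0 ≤ e (i + N) - e i := by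
        have := hmono.monotone (show i ≤ i + N by omega)
        omega
      obtain ⟨M, hM⟩ : ∃ M : ℕ, (M : ℤ) = n + (e (i + N) - e i) :=
        ⟨(n + (e (i + N) - e i)).toNat, by omega⟩
      have h1 := hext i j hij
      have h2 := hext i' j' hij'
      -- of two such right special factors of `x`, the shorter one is a suffix of the longer one
      have hsuffix := (rightSpecial_unique (n := M) (i := e i) (j := e j)
        (i' := e (i' + N) - (e (i + N) - e i)) (j' := e (j' + N) - (e (i + N) - e i))
        (hc M (by omega)) (block_eq_iff.2 fun t h0 ht => h1.2 t h0 (by omega))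
        (by
          rw [hM, show e i + (n + (e (i + N) - e i)) = e (i + N) + n by ring,
            show e j + (n + (e (i + N) - e i)) = e (j + N) + n by rw [h1.1]; ring]
          exact fun h => hne ((hy _ _).2 h))
        (block_eq_iff.2 fun t h0 ht => by
          have h3 := h2.2 (e (i' + N) - e i' - (e (i + N) - e i) + t) (by omega) (by omega)
          convert h3 using 2
          · ring
          · rw [h2.1]
            ring)
        (by
          rw [hM, show ∀ c, c - (e (i + N) - e i) + (n + (e (i + N) - e i)) = c + n from
            fun c => by ring, show ∀ c, c - (e (i + N) - e i) + (n + (e (i + N) - e i)) = c + n from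
            fun c => by ring]
          exact fun h => hne' ((hy _ _).2 h))).1
      have h3 := he.eq_add_sub (i := i) (i' := i') (N := N) (sub_add_cancel _ _).symm hM hsuffix
      refine block_eq_iff.2 fun t h0 ht => ?_
      rw [hy]
      have h4 := h3 (N - t).toNat (by omega)
      rw [show i' + N - (((N - t : ℤ).toNat : ℕ) : ℤ) = i' + t by omega,
        show i + N - (((N - t : ℤ).toNat : ℕ) : ℤ) = i + t by omega] at h4
      have h5 : e i ≤ e (i + t) := hmono.monotone (by omega)
      have h6 : e (i + t) < e (i + N) := hmono (by omega)
      have h7 := block_eq_iff.1 hsuffix (e (i + t) - e i + n) (by omega) (by omega)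
      rw [h4, add_assoc, h7]
      congr 1
      ring
    have hle : ∀ N, complexity y (N + 1) ≤ complexity y N + 1 := fun N =>
      complexity_succ_le_of_rightSpecial_unique fun i j i' j' hij hne hij' hne' => by
        rcases le_total (e (i + N) - e i) (e (i' + N) - e i') with h | h
        · exact hunique N i j i' j' hij hne hij' hne' h
        · exact (hunique N i' j' i j hij' hne' hij hne h).symm
    intro N
    refine le_antisymm ?_ (lt_complexity (fun h => hyap (Or.inl h)) N)
    induction N with
    | zero =>
      refine (Set.ncard_le_one_iff (finite_factorsOfLength y 0)).2 ?_
      rintro _ _ ⟨i, rfl⟩ ⟨j, rfl⟩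
      simp [block]
    | succ N ih => have := hle N; omega

end Derivation

/-! ### Minimal shift spaces -/

section Minimal

variable {A : Type*} [TopologicalSpace A]

theorem continuous_shift (m : ℤ) : Continuous (shift m : (ℤ → A) → ℤ → A) :=
  continuous_pi fun n => continuous_apply (n + m)

theorem isShiftSpace_orbitClosure [DiscreteTopology A] (x : ℤ → A) :
    IsShiftSpace (orbitClosure x) :=
  ⟨isClosed_closure, fun z hz => by
    rw [mem_orbitClosure_iff] at hz ⊢
    rwa [factors_shift]⟩

theorem isOpen_setOf_block_eq [DiscreteTopology A] (i : ℤ) (n : ℕ) (u : List A) :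
    IsOpen {z : ℤ → A | block z i n = u} := by
  have hcont : Continuous fun z : ℤ → A => fun t : Fin n => z (i + (t : ℤ)) :=
    continuous_pi fun t => continuous_apply _
  exact (isOpen_discrete {v : Fin n → A | List.ofFn v = u}).preimage hcont

variable [Finite A] [DiscreteTopology A] {X : Set (ℤ → A)}

/-- Only `S X ⊆ X` is part of the definition of a shift space; in a minimal one `S X = X`. -/
theorem IsMinimalShiftSpace.shift_mem (hX : IsMinimalShiftSpace X) (m : ℤ) {x : ℤ → A}
    (hx : x ∈ X) : shift m x ∈ X := by
  have himage : shift 1 '' X = X := by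
    refine (hX.2 _ ⟨(hX.1.1.isCompact.image (continuous_shift 1)).isClosed, ?_⟩ ?_).resolve_right ?_
    · rintro _ ⟨z, hz, rfl⟩
      exact ⟨_, hX.1.2 z hz, rfl⟩
    · rintro _ ⟨z, hz, rfl⟩
      exact hX.1.2 z hz
    · exact (Set.Nonempty.image _ ⟨x, hx⟩).ne_empty
  have hneg : ∀ z ∈ X, shift (-1) z ∈ X := by
    intro z hz
    rw [← himage] at hz
    obtain ⟨z', hz', rfl⟩ := hz
    rwa [shift_shift, neg_add_cancel, shift_zero]
  induction m using Int.induction_on with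
  | zero => rwa [shift_zero]
  | succ m ih =>
    have := hX.1.2 _ ih
    rwa [shift_shift, add_comm] at this
  | pred m ih =>
    have := hneg _ ih
    rwa [shift_shift, add_comm, ← sub_eq_add_neg] at this

theorem IsMinimalShiftSpace.orbitClosure_eq (hX : IsMinimalShiftSpace X) {x : ℤ → A}
    (hx : x ∈ X) : orbitClosure x = X := by
  refine (hX.2 _ (isShiftSpace_orbitClosure x) ?_).resolve_right ?_
  · refine closure_minimal ?_ hX.1.1
    rintro _ ⟨k, rfl⟩
    exact hX.shift_mem k hx
  · exact Set.Nonempty.ne_empty ⟨x, self_mem_orbitClosure x⟩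

theorem IsMinimalShiftSpace.isUniformlyRecurrent (hX : IsMinimalShiftSpace X) {x : ℤ → A}
    (hx : x ∈ X) : IsUniformlyRecurrent x := by
  rintro _ ⟨l, i₀, rfl⟩
  obtain ⟨F, hF⟩ := hX.1.1.isCompact.elim_finite_subcover
    (fun i : ℤ => {z : ℤ → A | block z i l = block x i₀ l})
    (fun i => isOpen_setOf_block_eq i l _) (by
      intro z hz
      rw [← hX.orbitClosure_eq hz, mem_orbitClosure_iff] at hx
      obtain ⟨j, hj⟩ := factors_subset_iff.1 hx i₀ l
      exact Set.mem_iUnion.2 ⟨j, hj.symm⟩)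
  obtain ⟨M, hM⟩ : ∃ M : ℕ, ∀ a ∈ F, -(M : ℤ) ≤ a ∧ a ≤ M :=
    ⟨F.sup Int.natAbs, fun a ha => by
      have := Finset.le_sup (f := Int.natAbs) ha
      omega⟩
  refine ⟨2 * M + l, ?_⟩
  rintro _ ⟨i, rfl⟩
  obtain ⟨j, hj, hj'⟩ := Set.mem_iUnion₂.1 (hF (hX.shift_mem (i + M) hx))
  have hj' : block (shift (i + M) x) j l = block x i₀ l := hj'
  rw [← hj', block_shift]
  have := hM j hj
  exact block_infix_block x (by omega) (by push_cast; omega)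

theorem IsMinimalShiftSpace.isAperiodic (hX : IsMinimalShiftSpace X) (hinf : X.Infinite)
    {x : ℤ → A} (hx : x ∈ X) : IsAperiodic x := by
  intro hper
  obtain ⟨z, p, hp, hzp, hf⟩ := hper.exists_periodic
  have hz : z ∈ X := by
    rw [← hX.orbitClosure_eq hx]
    exact mem_orbitClosure_iff.2 hf
  have hmul : ∀ q : ℤ, shift (p * q) z = z := by
    intro q
    induction q using Int.induction_on with
    | zero => simp [shift_zero]
    | succ q ih => rw [mul_add, mul_one, ← shift_shift, hzp, ih]
    | pred q ih =>
      conv_lhs => rw [← hzp]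
      rw [shift_shift, mul_sub, mul_one, sub_add_cancel, ih]
  have hfin : (orbit z).Finite := by
    refine ((Set.finite_Ico 0 p).image fun k => shift k z).subset ?_
    rintro _ ⟨k, rfl⟩
    refine ⟨k % p, ⟨Int.emod_nonneg _ hp.ne', Int.emod_lt_of_pos _ hp⟩, ?_⟩
    conv_rhs => rw [← Int.emod_add_mul_ediv k p, ← shift_shift, hmul]
  refine hinf ?_
  rw [← hX.orbitClosure_eq hz]
  unfold orbitClosure
  rwa [hfin.isClosed.closure_eq]

end Minimal

/-! ### Images of shift spaces -/

section OnShift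

theorem Substitution.onBiWord_mem_onShift {A B : Type*} (φ : Substitution A B)
    {Y : Set (ℤ → A)} {y : ℤ → A} (hy : y ∈ Y) : φ.onBiWord y ∈ φ.onShift Y :=
  ⟨y, hy, 0, φ.length_onLetter_pos _, (shift_zero _).symm⟩
variable {A B : Type*} [TopologicalSpace A] [TopologicalSpace B] [DiscreteTopology A]

theorem Substitution.continuous_onBiWord [Finite A] (φ : Substitution A B) :
    Continuous (φ.onBiWord : (ℤ → A) → ℤ → B) := by
  have key : ∀ (i : ℤ) (n : ℕ) (f : (Fin n → A) → B),
      Continuous fun y : ℤ → A => f fun t : Fin n => y (i + (t : ℤ)) := fun i n f =>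
    (continuous_of_discreteTopology (f := f)).comp (continuous_pi fun t => continuous_apply _)
  refine continuous_pi fun n => ?_
  match n with
  | Int.ofNat n =>
    exact key 0 (n + 1) fun v => (φ.onWord (List.ofFn v))[n]'(by
      have := φ.length_le_onWord (List.ofFn v)
      rw [List.length_ofFn] at this
      omega)
  | Int.negSucc n =>
    exact key (Int.negSucc n) (n + 1) fun v =>
      (φ.onWord (List.ofFn v))[(φ.onWord (List.ofFn v)).length - (n + 1)]'(by
        have := φ.length_le_onWord (List.ofFn v)
        rw [List.length_ofFn] at this
        omega)

variable [DiscreteTopology B]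

theorem Substitution.isShiftSpace_onShift [Finite A] (φ : Substitution A B) {Y : Set (ℤ → A)}
    (hY : IsShiftSpace Y) : IsShiftSpace (φ.onShift Y) := by
  constructor
  · have heq : φ.onShift Y = ⋃ a : A, ⋃ k ∈ Finset.range (φ.onLetter a).length,
        (fun y => shift (k : ℤ) (φ.onBiWord y)) '' (Y ∩ {y | y 0 = a}) := by
      ext z
      simp only [Substitution.onShift, Set.mem_ofPred_eq, Set.mem_iUnion, Set.mem_image,
        Finset.mem_range, Set.mem_inter_iff]
      constructor
      · rintro ⟨y, hy, k, hk, rfl⟩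
        exact ⟨y 0, k, hk, y, ⟨hy, rfl⟩, rfl⟩
      · rintro ⟨_, k, hk, y, ⟨hy, rfl⟩, rfl⟩
        exact ⟨y, hy, k, hk, rfl⟩
    rw [heq]
    refine IsCompact.isClosed (isCompact_iUnion fun a => Finset.isCompact_biUnion _ fun k _ => ?_)
    refine IsCompact.image ?_ ((continuous_shift _).comp φ.continuous_onBiWord)
    refine (hY.1.inter ?_).isCompact
    exact isClosed_eq (continuous_apply (0 : ℤ)) continuous_const
  · rintro _ ⟨y, hy, k, hk, rfl⟩
    rw [shift_shift]
    by_cases hk' : k + 1 < (φ.onLetter (y 0)).length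
    · exact ⟨y, hy, k + 1, hk', by rw [add_comm]; rfl⟩
    · refine ⟨shift 1 y, hY.2 y hy, 0, φ.length_onLetter_pos _, ?_⟩
      rw [φ.onBiWord_shift, Nat.cast_zero, shift_zero]
      congr 1
      have h := (φ.isParsing_onBiWord y).succ 0
      rw [φ.cut_zero, zero_add, zero_add] at h
      rw [h]
      omega

theorem IsMinimalShiftSpace.eq_onShift [Finite A] {X : Set (ℤ → B)} (hX : IsMinimalShiftSpace X)
    (φ : Substitution A B) {x : ℤ → B} {y : ℤ → A} {m : ℤ} (hX' : X = orbitClosure x)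
    (hx : x = shift m (φ.onBiWord y)) : X = φ.onShift (orbitClosure y) := by
  refine ((hX.2 _ (φ.isShiftSpace_onShift (isShiftSpace_orbitClosure y)) ?_).resolve_right
    ?_).symm
  · rintro _ ⟨z, hz, k, -, rfl⟩
    rw [mem_orbitClosure_iff] at hz
    rw [hX', mem_orbitClosure_iff, factors_shift, hx, factors_shift]
    exact φ.factors_onBiWord_subset hz
  · exact Set.Nonempty.ne_empty ⟨_, φ.onBiWord_mem_onShift (self_mem_orbitClosure y)⟩

end OnShift

/-! ### Words and shift spaces of finite span -/

section FiniteSpan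

variable {A : Type*} [TopologicalSpace A] [DiscreteTopology A]

theorem IsQuasiSturmian.of_hasFiniteSpan [Finite A] {x z : ℤ → A} (hx : IsAperiodic x)
    (hu : IsUniformlyRecurrent x) (hz : z ∈ orbitClosure x) (hspan : HasFiniteSpan z) :
    IsQuasiSturmian x := by
  obtain ⟨a, b, hab⟩ := hasFiniteSpan_iff.1 hspan
  refine hx.isQuasiSturmian (C := (b - a).toNat) fun n hn => ?_
  rw [← complexity_congr (hu.factors_eq (mem_orbitClosure_iff.1 hz))]
  exact hab.complexity_le hn

theorem exists_hasFiniteSpan_of_eq_shift_onBiWord {x : ℤ → A} (hx : IsAperiodic x)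
    (hu : IsUniformlyRecurrent x) {φ : Substitution (Fin 2) A} {m : ℤ} {y : ℤ → Fin 2}
    (hy : IsSturmian y) (hxy : x = shift m (φ.onBiWord y)) :
    ∃ z ∈ orbitClosure x, HasFiniteSpan z := by
  obtain ⟨z, hzy, hz⟩ := hy.exists_isStringAttractor fun z hz =>
    hx.of_factors_subset_preimage hu hxy hz
  refine ⟨φ.onBiWord z, ?_, ?_⟩
  · rw [mem_orbitClosure_iff, hxy, factors_shift]
    exact φ.factors_onBiWord_subset hzy
  · rw [hasFiniteSpan_iff]
    exact ⟨0, φ.cut z 2 - 1, by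
      convert hz.onBiWord φ using 1
      ext t
      simp⟩

variable [Finite A]

theorem tfae_of_isUniformlyRecurrent {x : ℤ → A} (hx : IsAperiodic x)
    (hu : IsUniformlyRecurrent x) :
    List.TFAE [
      ∃ z ∈ orbitClosure x, HasFiniteSpan z,
      IsQuasiSturmian x,
      ∃ (φ : Substitution (Fin 2) A) (m : ℤ) (y : ℤ → Fin 2),
        IsReturnMorphism φ ∧ IsSturmian y ∧ x = shift m (φ.onBiWord y),
      ∃ (φ : Substitution (Fin 2) A) (m : ℤ) (y : ℤ → Fin 2),
        IsAcyclic φ ∧ IsSturmian y ∧ x = shift m (φ.onBiWord y)] := by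
  tfae_have 1 → 2 := fun ⟨_, hz, hspan⟩ => IsQuasiSturmian.of_hasFiniteSpan hx hu hz hspan
  tfae_have 2 → 3 := fun h => h.exists_isReturnMorphism hu
  tfae_have 3 → 4 := fun ⟨φ, m, y, hφ, h⟩ => ⟨φ, m, y, hφ.isAcyclic, h⟩
  tfae_have 4 → 1 := fun ⟨_, _, _, _, hy, hxy⟩ =>
    exists_hasFiniteSpan_of_eq_shift_onBiWord hx hu hy hxy
  tfae_finish

theorem tfae_of_isMinimalShiftSpace {X : Set (ℤ → A)} (hX : IsMinimalShiftSpace X)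
    (hinf : X.Infinite) :
    List.TFAE [
      ∃ x ∈ X, HasFiniteSpan x,
      IsQuasiSturmianShift X,
      ∃ (φ : Substitution (Fin 2) A) (Y : Set (ℤ → Fin 2)),
        IsReturnMorphism φ ∧ IsSturmianShift Y ∧ X = φ.onShift Y,
      ∃ (φ : Substitution (Fin 2) A) (Y : Set (ℤ → Fin 2)),
        IsAcyclic φ ∧ IsSturmianShift Y ∧ X = φ.onShift Y] := by
  tfae_have 1 → 2 := by
    rintro ⟨x, hx, hspan⟩
    exact ⟨x, IsQuasiSturmian.of_hasFiniteSpan (hX.isAperiodic hinf hx)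
      (hX.isUniformlyRecurrent hx) (self_mem_orbitClosure x) hspan, (hX.orbitClosure_eq hx).symm⟩
  tfae_have 2 → 3 := by
    rintro ⟨x, hqs, hxX⟩
    have hx : x ∈ X := hxX ▸ self_mem_orbitClosure x
    obtain ⟨φ, m, y, hφ, hy, hxy⟩ := hqs.exists_isReturnMorphism (hX.isUniformlyRecurrent hx)
    exact ⟨φ, orbitClosure y, hφ, ⟨y, hy, rfl⟩, hX.eq_onShift φ hxX hxy⟩
  tfae_have 3 → 4 := fun ⟨φ, Y, hφ, h⟩ => ⟨φ, Y, hφ.isAcyclic, h⟩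
  tfae_have 4 → 1 := by
    rintro ⟨φ, _, -, ⟨y, hy, rfl⟩, hXY⟩
    have hx : φ.onBiWord y ∈ X := by
      rw [hXY]
      exact φ.onBiWord_mem_onShift (self_mem_orbitClosure y)
    obtain ⟨z, hz, hspan⟩ := exists_hasFiniteSpan_of_eq_shift_onBiWord (hX.isAperiodic hinf hx)
      (hX.isUniformlyRecurrent hx) (m := 0) hy (shift_zero _).symm
    exact ⟨z, hX.orbitClosure_eq hx ▸ hz, hspan⟩
  tfae_finish

end FiniteSpan

end BiInfiniteWord

theorem propositionP {A : Type*} [Finite A] [TopologicalSpace A] [DiscreteTopology A] :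
    (∀ x : ℤ → A, IsAperiodic x → IsUniformlyRecurrent x →
      List.TFAE [
        ∃ z ∈ orbitClosure x, HasFiniteSpan z,
        IsQuasiSturmian x,
        ∃ (φ : Substitution (Fin 2) A) (m : ℤ) (y : ℤ → Fin 2),
          IsReturnMorphism φ ∧ IsSturmian y ∧ x = shift m (φ.onBiWord y),
        ∃ (φ : Substitution (Fin 2) A) (m : ℤ) (y : ℤ → Fin 2),
          IsAcyclic φ ∧ IsSturmian y ∧ x = shift m (φ.onBiWord y)]) ∧
    (∀ X : Set (ℤ → A), IsMinimalShiftSpace X → X.Infinite →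
      List.TFAE [
        ∃ x ∈ X, HasFiniteSpan x,
        IsQuasiSturmianShift X,
        ∃ (φ : Substitution (Fin 2) A) (Y : Set (ℤ → Fin 2)),
          IsReturnMorphism φ ∧ IsSturmianShift Y ∧ X = φ.onShift Y,
        ∃ (φ : Substitution (Fin 2) A) (Y : Set (ℤ → Fin 2)),
          IsAcyclic φ ∧ IsSturmianShift Y ∧ X = φ.onShift Y]) := by
  exact ⟨fun _ hx hu => tfae_of_isUniformlyRecurrent hx hu,
    fun _ hX hinf => tfae_of_isMinimalShiftSpace hX hinf⟩
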